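/- Let $B$ be a $C^*$-algebra and let $E$ be a Hilbert $C^*$-module over $B$ (a complete inner product $B$-module whose $B$-valued inner product $\langle\cdot,\cdot\rangle$ is $B$-linear in the second variable). An operator $T$ in $E$ with domain $\mathscr D(T)$ is called *self-adjoint* if it is a densely defined $B$-linear operator, its domain is a $B$-submodule, and $T$ equals its adjoint $T^*$, including domains; here $y\in\mathscr D(T^*)$ and $T^*y=z$ mean that $\langle Tx,y\rangle=\langle x,z\rangle$ for all $x\in\mathscr D(T)$. A self-adjoint operator $T$ is called *regular* if $T+\lambda$ and $T-\lambda$ have dense range for one (equivalently, for every) $\lambda\in\mathbb C\setminus\mathbb R$. The sum $S+T$ of two operators is defined on $\mathscr D(S)\cap\mathscr D(T)$. For self-adjoint regular operators $S,T$ in $E$ put $$\mathscr F(S,T)=\{x\in\mathscr D(S)\cap\mathscr D(T)\;:\;Sx\in\mathscr D(T),\ Tx\in\mathscr D(S)\},\qquad [S,T]x=STx+TSx\quad(x\in\mathscr F(S,T)).$$ The pair $(S,T)$ is called *weakly anticommuting* if 1. there are constants $C_0,C_1,C_2>0$ such that, as an inequality in $B$, $$\langle [S,T]x,[S,T]x\rangle\le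 C_0\langle x,x\rangle+C_1\langle Sx,Sx\rangle+C_2\langle Tx,Tx\rangle\qquad\text{for all }x\in\mathscr F(S,T);$$ 2. there are a core $\mathscr E\subset\mathscr D(T)$ for $T$ (a linear subspace such that $T$ is the closure of $T|_{\mathscr E}$) and a $\lambda_0>0$ such that $(S+\lambda)^{-1}(\mathscr E)\subset\mathscr F(S,T)$ for all $\lambda\in i\mathbb R$ with $|\lambda|\ge\lambda_0$. **Theorem.** Let $S_1,S_2,S_3$ be self-adjoint and regular operators in $E$ such that the pairs $(S_1,S_2)$, $(S_2,S_3)$ and $(S_1,S_3)$ are weakly anticommuting. Then $S_1+S_2$ is self-adjoint and regular and the pair $(S_1+S_2,S_3)$ is weakly anticommuting. Hence $S_1+S_2+S_3$ is self-adjoint and regular on $\mathscr D(S_1)\cap\mathscr D(S_2)\cap\mathscr D(S_3)$. -/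

import Mathlib

/-!
Unbounded operators in a Hilbert C⋆-module `E` over a C⋆-algebra `A` are partially defined
`ℂ`-linear maps `T : E →ₗ.[ℂ] E`; the `A`-valued inner product `inner A x y` is Mathlib's
(`A`-linear in the second variable). Mathlib writes the action of `A` on the left, so a right
Hilbert C⋆-module over `B` is a Hilbert C⋆-module over `A = Bᵐᵒᵖ` here.
-/

namespace HilbertModuleOp

section Operators

variable (A : Type*) {E : Type*} [NonUnitalCStarAlgebra A] [PartialOrder A] [StarOrderedRing A]
  [NormedAddCommGroup E] [NormedSpace ℂ E] [SMul A E] [CStarModule A E]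

/-- The graph of the adjoint of `T` with respect to the `A`-valued inner product: all pairs
`(y, z)` with `⟨T x, y⟩ = ⟨x, z⟩` for every `x` in the domain of `T`. -/
def adjointGraph (T : E →ₗ.[ℂ] E) : Set (E × E) :=
  {p | ∀ x : T.domain, inner A (T x) p.1 = inner A (x : E) p.2}

/-- A self-adjoint operator in the Hilbert C⋆-module `E`: a densely defined `A`-linear operator,
whose domain is an `A`-submodule, that is equal (including domains) to its adjoint. -/
structure IsSelfAdjointOp (T : E →ₗ.[ℂ] E) : Prop where
  dense_domain : Dense (T.domain : Set E)
  smul_mem : ∀ (a : A) (x : T.domain), a • (x : E) ∈ T.domain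
  map_smul : ∀ (a : A) (x : T.domain), T ⟨a • (x : E), smul_mem a x⟩ = a • T x
  eq_adjoint : (T.graph : Set (E × E)) = adjointGraph A T

/-- A self-adjoint regular operator: `T` is self-adjoint and, for some non-real `l`, both `T + l`
and `T - l` have dense range. -/
structure IsSelfAdjointRegular (T : E →ₗ.[ℂ] E) : Prop extends IsSelfAdjointOp A T where
  regular : ∃ l : ℂ, l.im ≠ 0 ∧
    Dense (Set.range fun x : T.domain => T x + l • (x : E)) ∧
    Dense (Set.range fun x : T.domain => T x - l • (x : E))

/-- Membership in the domain `F(S, T)` of the anticommutator: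
`x ∈ D(S) ∩ D(T)`, `S x ∈ D(T)` and `T x ∈ D(S)`. -/
structure MemF (S T : E →ₗ.[ℂ] E) (x : E) : Prop where
  mem_left : x ∈ S.domain
  mem_right : x ∈ T.domain
  left_apply_mem : S ⟨x, mem_left⟩ ∈ T.domain
  right_apply_mem : T ⟨x, mem_right⟩ ∈ S.domain

/-- The anticommutator `[S, T] x = S (T x) + T (S x)` for `x ∈ F(S, T)`. -/
def anticommutator (S T : E →ₗ.[ℂ] E) (x : E) (hx : MemF S T x) : E :=
  S ⟨T ⟨x, hx.mem_right⟩, hx.right_apply_mem⟩ + T ⟨S ⟨x, hx.mem_left⟩, hx.left_apply_mem⟩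

/-- The set `(S + l)⁻¹ (V)`: all `x ∈ D(S)` with `S x + l x ∈ V`. (If `S` is self-adjoint and
regular and `l` is not real then `S + l : D(S) → E` is bijective, so that this is the image of `V`
under the resolvent.) -/
def resolventImage (S : E →ₗ.[ℂ] E) (l : ℂ) (V : Submodule ℂ E) : Set E :=
  {x | ∃ h : x ∈ S.domain, S ⟨x, h⟩ + l • x ∈ V}

/-- The pair `(S, T)` is weakly anticommuting. The imaginary resolvent parameter is `t * I`, with
`t` real and `l₀ ≤ |t|`. -/
structure WeaklyAnticommuting (S T : E →ₗ.[ℂ] E) : Prop where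
  left_isSelfAdjointRegular : IsSelfAdjointRegular A S
  right_isSelfAdjointRegular : IsSelfAdjointRegular A T
  form_estimate : ∃ C₀ C₁ C₂ : ℝ, 0 < C₀ ∧ 0 < C₁ ∧ 0 < C₂ ∧ ∀ (x : E) (hx : MemF S T x),
    inner A (anticommutator S T x hx) (anticommutator S T x hx) ≤
      C₀ • inner A x x
        + C₁ • inner A (S ⟨x, hx.mem_left⟩) (S ⟨x, hx.mem_left⟩)
        + C₂ • inner A (T ⟨x, hx.mem_right⟩) (T ⟨x, hx.mem_right⟩)
  core_condition : ∃ V : Submodule ℂ E, T.HasCore V ∧ ∃ l₀ : ℝ, 0 < l₀ ∧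
    ∀ t : ℝ, l₀ ≤ |t| → ∀ x ∈ resolventImage S ((t : ℂ) * Complex.I) V, MemF S T x

end Operators

end HilbertModuleOp

open Filter Topology Complex

set_option linter.unusedSectionVars false

namespace HilbertModuleOp

/-! ### Estimates for the `A`-valued inner product and weak limits. -/

section Inner

variable (A : Type*) {E : Type*} [NonUnitalCStarAlgebra A] [PartialOrder A] [StarOrderedRing A]
  [NormedAddCommGroup E] [NormedSpace ℂ E] [SMul A E] [CStarModule A E]

/-! Self-adjoint regular operators enter as symmetric, densely defined operators with all shifts `S
+ i t`, `t ≠ 0`, onto (`IsSymmSurj`). Weak anticommutation enters as a form bound with one constant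
`C` (`FormEstimate`) together with the invariance of `D(T)`: `(S + i τ)⁻¹` maps all of `D(T)` into
`F(S, T)` for large `|τ|` (`ResolventMapsDomain`). The passage from a core to all of `D(T)` is a
closedness argument, `isClosed_resolventGraph`, resting on the identity `(S - iτ)Ty = [S,T]y - Tx`
for `y = (S + iτ)⁻¹x`.

Sum of two. The form bound extends `[S,T]` to `D(S) ∩ D(T)`, and completing a square shows that `S +
T` controls `S` and `T` separately (`coercive`); hence `S + T + iμ` has closed range. For dense
range, `S` is replaced by its bounded Yosida approximation `iτS(S + iτ)⁻¹`. The resulting equation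
is solvable by a Neumann series, its solutions satisfy bounds uniform in `τ`, and regularizing them
gives elements of the range that converge weakly to the given vector. Convex combinations turn this
into norm convergence (`mem_closure_of_weak_limit`), so no self-duality of the module is needed.

Third operator. The resolvent of `S₁ + S₂` is hard to compare with `S₃`, whereas that of `S₃` acts
on `D(S₁) ∩ D(S₂)` one operator at a time. So the point is that weak anticommutation is symmetric in
the two operators (`ResolventMapsDomain.swap`): swap both pairs, add, and swap back. The form bound
for the sum follows from the two extended anticommutators and coercivity of `S₁ + S₂`. -/

theorem inner_ext {x y : E} (h : ∀ u : E, inner A u x = inner A u y) : x = y := by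
  have : inner A (x - y) (x - y) = 0 := by
    rw [CStarModule.inner_sub_right, h, sub_self]
  exact sub_eq_zero.1 (CStarModule.inner_self.1 this)

theorem inner_ext_dense {D : Set E} (hD : Dense D) {x y : E}
    (h : ∀ u ∈ D, inner A u x = inner A u y) : x = y := by
  refine inner_ext A fun u => ?_
  have hc : ∀ z : E, Continuous fun u : E => inner A u z := fun z =>
    CStarModule.continuous_inner.comp (continuous_id.prodMk continuous_const)
  exact congrFun (Continuous.ext_on hD (hc x) (hc y) h) u

theorem op_smul_add (a : A) (x y : E) : a • (x + y) = a • x + a • y :=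
  inner_ext A fun u => by simp [mul_add]

theorem norm_sq_le_of_inner_le {x : E} {b : A} (h : inner A x x ≤ b) : ‖x‖ ^ 2 ≤ ‖b‖ := by
  rw [CStarModule.norm_sq_eq A]
  exact CStarAlgebra.norm_le_norm_of_nonneg_of_le CStarModule.inner_self_nonneg h

theorem norm_le_norm_of_inner_le {x y : E} (h : inner A x x ≤ inner A y y) : ‖x‖ ≤ ‖y‖ := by
  have := norm_sq_le_of_inner_le A h
  rw [← CStarModule.norm_sq_eq A] at this
  exact le_of_sq_le_sq this (norm_nonneg _)

theorem norm_inner_self (x : E) : ‖inner A x x‖ = ‖x‖ ^ 2 := (CStarModule.norm_sq_eq A).symm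

theorem inner_add_self_le (x y : E) :
    inner A (x + y) (x + y) ≤ (2 : ℝ) • inner A x x + (2 : ℝ) • inner A y y := by
  have h : (0 : A) ≤ inner A (x - y) (x - y) := CStarModule.inner_self_nonneg
  rw [← sub_nonneg]
  convert h using 1
  simp only [CStarModule.inner_add_left, CStarModule.inner_add_right, CStarModule.inner_sub_left,
    CStarModule.inner_sub_right]
  module

/-- Symmetry makes the two cross terms cancel, as `i t` is skew. Both resolvent bounds below come
from dropping one of the two positive terms. -/
theorem inner_add_I_smul_self {x x' : E} (h : inner A x' x = inner A x x') (t : ℝ) :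
    inner A (x' + ((t : ℂ) * I) • x) (x' + ((t : ℂ) * I) • x) =
      inner A x' x' + (t ^ 2) • inner A x x := by
  simp only [CStarModule.inner_add_left, CStarModule.inner_add_right,
    CStarModule.inner_smul_left_complex, CStarModule.inner_smul_right_complex, h]
  have hs : star ((t : ℂ) * I) = -((t : ℂ) * I) := by simp
  rw [hs]
  have e : (t ^ 2) • inner A x x = ((t : ℂ) ^ 2) • inner A x x := by
    rw [← Complex.ofReal_pow]; rfl
  have e2 : (t : ℂ) ^ 2 = -((t : ℂ) * I) * ((t : ℂ) * I) := by
    linear_combination ((t : ℂ) ^ 2) * I_sq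
  rw [e, e2]
  module

theorem abs_mul_norm_le {x x' : E} (h : inner A x' x = inner A x x') (t : ℝ) :
    |t| * ‖x‖ ≤ ‖x' + ((t : ℂ) * I) • x‖ := by
  have h0 : inner A (t • x) (t • x) ≤
      inner A (x' + ((t : ℂ) * I) • x) (x' + ((t : ℂ) * I) • x) := by
    rw [inner_add_I_smul_self A h]
    simp only [CStarModule.inner_smul_left_real, CStarModule.inner_smul_right_real, smul_smul,
      pow_two]
    exact le_add_of_nonneg_left CStarModule.inner_self_nonneg
  simpa [norm_smul] using norm_le_norm_of_inner_le A h0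

theorem norm_le_norm_add_I_smul {x x' : E} (h : inner A x' x = inner A x x') (t : ℝ) :
    ‖x'‖ ≤ ‖x' + ((t : ℂ) * I) • x‖ := by
  refine norm_le_norm_of_inner_le A ?_
  rw [inner_add_I_smul_self A h]
  exact le_add_of_nonneg_right (smul_nonneg (sq_nonneg t) CStarModule.inner_self_nonneg)

theorem tendsto_inner {ι : Type*} {l : Filter ι} {u v : ι → E} {x y : E}
    (hu : Tendsto u l (𝓝 x)) (hv : Tendsto v l (𝓝 y)) :
    Tendsto (fun i => inner A (u i) (v i)) l (𝓝 (inner A x y)) :=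
  (CStarModule.continuous_inner.tendsto (x, y)).comp (hu.prodMk_nhds hv)

/-- Bounded sequences that converge weakly on a dense set converge weakly. -/
theorem tendsto_inner_of_dense {D : Set E} (hD : Dense D) {v : ℕ → E} {z : E} {M : ℝ}
    (hM : ∀ n, ‖v n‖ ≤ M)
    (h : ∀ u ∈ D, Tendsto (fun n => inner A u (v n - z)) atTop (𝓝 0)) (u : E) :
    Tendsto (fun n => inner A u (v n - z)) atTop (𝓝 0) := by
  rw [Metric.tendsto_atTop]
  intro ε hε
  have hM0 : 0 ≤ M := (norm_nonneg _).trans (hM 0)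
  set K := M + ‖z‖ + 1 with hK
  have hKpos : 0 < K := by positivity
  obtain ⟨w, hw, hwd⟩ := hD.exists_dist_lt u (show 0 < ε / (2 * K) by positivity)
  obtain ⟨N, hN⟩ := Metric.tendsto_atTop.1 (h w hw) (ε / 2) (by positivity)
  refine ⟨N, fun n hn => ?_⟩
  have h1 := hN n hn
  rw [dist_zero_right] at h1 ⊢
  have e : inner A u (v n - z) = inner A (u - w) (v n - z) + inner A w (v n - z) := by
    rw [CStarModule.inner_sub_left]; abel
  have h2 : ‖inner A (u - w) (v n - z)‖ ≤ ε / (2 * K) * K := by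
    refine (CStarModule.norm_inner_le E).trans ?_
    rw [dist_eq_norm] at hwd
    have : ‖v n - z‖ ≤ K := (norm_sub_le _ _).trans (by linarith [hM n])
    gcongr
  have h3 : ε / (2 * K) * K = ε / 2 := by field_simp
  rw [e]
  linarith [norm_add_le (inner A (u - w) (v n - z)) (inner A w (v n - z))]

/-- A Banach–Saks argument: a closed submodule of a product that contains `(u n, v n)` for all
`n` contains the pair of the norm limit of `u` and the weak limit of the bounded sequence `v`. -/
theorem mem_closure_of_weak_limit {F : Type*} [NormedAddCommGroup F] [NormedSpace ℂ F]
    (K : Submodule ℂ (F × E)) {u : ℕ → F} {v : ℕ → E} {x : F} {z : E} {M : ℝ}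
    (hK : ∀ n, (u n, v n) ∈ K) (hu : Tendsto u atTop (𝓝 x)) (hM : ∀ n, ‖v n‖ ≤ M)
    (hv : ∀ y : E, Tendsto (fun n => inner A y (v n - z)) atTop (𝓝 0)) :
    (x, z) ∈ closure (K : Set (F × E)) := by
  have hM0 : 0 ≤ M := (norm_nonneg _).trans (hM 0)
  -- The extra `1` pays for the cross term in each averaging step.
  set B := (M + ‖z‖) ^ 2 + 1 with hB
  have hB0 : 0 < B := by positivity
  have hvz : ∀ n, ‖v n - z‖ ^ 2 ≤ B - 1 := fun n => by
    have : ‖v n - z‖ ≤ M + ‖z‖ := (norm_sub_le _ _).trans (by linarith [hM n])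
    rw [hB, add_sub_cancel_right]; gcongr
  have key : ∀ δ > 0, ∀ k : ℕ, ∃ c : F × E, c ∈ K ∧ dist c.1 x ≤ δ ∧
      ((k : ℝ) + 1) * ‖c.2 - z‖ ^ 2 ≤ B := by
    intro δ hδ k
    obtain ⟨N, hN⟩ := Metric.tendsto_atTop.1 hu δ hδ
    induction k with
    | zero =>
      refine ⟨(u N, v N), hK N, (hN N le_rfl).le, ?_⟩
      have := hvz N
      simp only [Nat.cast_zero, zero_add, one_mul]
      linarith
    | succ k ih =>
      obtain ⟨c, hcK, hc1, hc2⟩ := ih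
      have hk : (0 : ℝ) < 2 * (k + 1) := by positivity
      -- Weak convergence, tested against the current error, makes the next error almost orthogonal
      -- to it. With the running-average weights below, `(k+2)²` times the new squared error is at
      -- most `(k+1)B + 1 + (B-1)`.
      obtain ⟨N', hN'⟩ := Metric.tendsto_atTop.1 (hv (c.2 - z)) (1 / (2 * (k + 1)))
        (by positivity)
      set n := max N N' with hn
      have hin := hN' n (le_max_right _ _)
      rw [dist_zero_right] at hin
      set a : ℝ := (k + 1) / (k + 2) with ha
      set b : ℝ := 1 / (k + 2) with hb
      have hab : a + b = 1 := by rw [ha, hb]; field_simp; ring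
      have ha0 : 0 ≤ a := by positivity
      have hb0 : 0 ≤ b := by positivity
      refine ⟨(a : ℂ) • c + (b : ℂ) • (u n, v n),
        K.add_mem (K.smul_mem _ hcK) (K.smul_mem _ (hK n)), ?_, ?_⟩
      · have := (convex_closedBall x δ) (Metric.mem_closedBall.2 hc1)
          (Metric.mem_closedBall.2 (hN n (le_max_left _ _)).le) ha0 hb0 hab
        exact Metric.mem_closedBall.1 this
      · have e : ((a : ℂ) • c + (b : ℂ) • (u n, v n)).2 - z = a • (c.2 - z) + b • (v n - z) := by
          have : z = a • z + b • z := by rw [← add_smul, hab, one_smul]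
          have e1 : ((a : ℂ) • c + (b : ℂ) • (u n, v n)).2 = a • c.2 + b • v n := rfl
          rw [e1]
          conv_lhs => rw [this]
          module
        rw [e]
        set p := c.2 - z
        set q := v n - z
        have e2 : inner A (a • p + b • q) (a • p + b • q) =
            (a ^ 2) • inner A p p + (a * b) • (inner A p q + star (inner A p q))
              + (b ^ 2) • inner A q q := by
          simp only [CStarModule.inner_add_left, CStarModule.inner_add_right,
            CStarModule.inner_smul_left_real, CStarModule.inner_smul_right_real,
            CStarModule.star_inner]
          module
        have h3 : ‖a • p + b • q‖ ^ 2 ≤ a ^ 2 * ‖p‖ ^ 2 + a * b * (2 * ‖inner A p q‖)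
            + b ^ 2 * ‖q‖ ^ 2 := by
          rw [← norm_inner_self A, e2]
          refine (norm_add₃_le).trans ?_
          rw [norm_smul, norm_smul, norm_smul, norm_inner_self, norm_inner_self,
            Real.norm_of_nonneg (sq_nonneg a), Real.norm_of_nonneg (sq_nonneg b),
            Real.norm_of_nonneg (mul_nonneg ha0 hb0)]
          have : ‖inner A p q + star (inner A p q)‖ ≤ 2 * ‖inner A p q‖ := by
            refine (norm_add_le _ _).trans ?_
            rw [norm_star]; linarith
          gcongr
        have h4 : (2 * ((k : ℝ) + 1)) * ‖inner A p q‖ ≤ 1 := by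
          rw [lt_div_iff₀ hk] at hin; linarith
        have h5 := hvz n
        have h6 : ((k : ℝ) + 2) ^ 2 * (a ^ 2 * ‖p‖ ^ 2 + a * b * (2 * ‖inner A p q‖)
            + b ^ 2 * ‖q‖ ^ 2) = (k + 1) * ((k + 1) * ‖p‖ ^ 2)
              + (2 * ((k : ℝ) + 1)) * ‖inner A p q‖ + ‖q‖ ^ 2 := by
          rw [ha, hb]; field_simp
        have h7 : ((k : ℝ) + 2) ^ 2 * ‖a • p + b • q‖ ^ 2 ≤ (k + 2) * B := by
          have : ((k : ℝ) + 1) * ((k + 1) * ‖p‖ ^ 2) ≤ (k + 1) * B := by gcongr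
          have h8 := mul_le_mul_of_nonneg_left h3 (sq_nonneg ((k : ℝ) + 2))
          rw [h6] at h8
          linarith
        have h9 : ((k : ℝ) + 2) * (((k : ℝ) + 2) * ‖a • p + b • q‖ ^ 2) ≤ (k + 2) * B := by
          rw [← mul_assoc, ← pow_two]; exact h7
        have := le_of_mul_le_mul_left h9 (by positivity)
        push_cast
        rw [show (k : ℝ) + 1 + 1 = k + 2 by ring]
        exact this
  rw [Metric.mem_closure_iff]
  intro ε hε
  obtain ⟨k, hk⟩ := exists_nat_gt (B / ε ^ 2)
  obtain ⟨c, hcK, hc1, hc2⟩ := key (ε / 2) (by positivity) k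
  refine ⟨c, hcK, ?_⟩
  rw [Prod.dist_eq, max_lt_iff, dist_comm, dist_comm (x, z).2]
  refine ⟨by simp only; linarith, ?_⟩
  rw [dist_eq_norm]
  rw [div_lt_iff₀ (by positivity)] at hk
  have h1 : ‖c.2 - z‖ ^ 2 < ε ^ 2 := by
    have hk1 : (0 : ℝ) < k + 1 := by positivity
    refine lt_of_mul_lt_mul_left (a := (k : ℝ) + 1) ?_ hk1.le
    nlinarith [sq_nonneg ε]
  exact lt_of_pow_lt_pow_left₀ 2 hε.le h1

end Inner

/-! ### Symmetric operators with surjective imaginary shifts, and their resolvents. -/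

section Resolvent

variable (A : Type*) {E : Type*} [NonUnitalCStarAlgebra A] [PartialOrder A] [StarOrderedRing A]
  [NormedAddCommGroup E] [NormedSpace ℂ E] [SMul A E] [CStarModule A E]

/-- A densely defined symmetric operator `S` such that `S + i t` is surjective for all real
`t ≠ 0`. -/
structure IsSymmSurj (S : E →ₗ.[ℂ] E) : Prop where
  symm : ∀ {x x' y y' : E}, (x, x') ∈ S.graph → (y, y') ∈ S.graph → inner A x' y = inner A x y'
  surj : ∀ t : ℝ, t ≠ 0 → ∀ z : E, ∃ x x', (x, x') ∈ S.graph ∧ x' + ((t : ℂ) * I) • x = z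
  dense : Dense (S.domain : Set E)

variable {A} {S T : E →ₗ.[ℂ] E}

namespace IsSymmSurj

theorem abs_mul_norm_le (hS : IsSymmSurj A S) {x x' : E} (h : (x, x') ∈ S.graph) (t : ℝ) :
    |t| * ‖x‖ ≤ ‖x' + ((t : ℂ) * I) • x‖ :=
  HilbertModuleOp.abs_mul_norm_le A (hS.symm h h) t

theorem norm_le (hS : IsSymmSurj A S) {x x' : E} (h : (x, x') ∈ S.graph) (t : ℝ) :
    ‖x'‖ ≤ ‖x' + ((t : ℂ) * I) • x‖ :=
  HilbertModuleOp.norm_le_norm_add_I_smul A (hS.symm h h) t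

theorem eq_of_shift_eq (hS : IsSymmSurj A S) {t : ℝ} (ht : t ≠ 0) {x x' y y' : E}
    (hx : (x, x') ∈ S.graph) (hy : (y, y') ∈ S.graph)
    (h : x' + ((t : ℂ) * I) • x = y' + ((t : ℂ) * I) • y) : x = y := by
  have h1 := hS.abs_mul_norm_le (S.graph.sub_mem hx hy) t
  have h2 : x' - y' + ((t : ℂ) * I) • (x - y) = 0 := by
    have : x' - y' + ((t : ℂ) * I) • (x - y) =
      (x' + ((t : ℂ) * I) • x) - (y' + ((t : ℂ) * I) • y) := by module
    rw [this, h, sub_self]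
  simp only [h2, norm_zero] at h1
  exact sub_eq_zero.1 (norm_le_zero_iff.1 (nonpos_of_mul_nonpos_right h1 (abs_pos.2 ht)))

theorem exists_resolvent (hS : IsSymmSurj A S) {t : ℝ} (ht : t ≠ 0) :
    ∃ R : E →L[ℂ] E, ∀ z, (R z, z - ((t : ℂ) * I) • R z) ∈ S.graph := by
  choose r r' hr hr' using hS.surj t ht
  have uniq : ∀ {y y' : E}, (y, y') ∈ S.graph → r (y' + ((t : ℂ) * I) • y) = y := by
    intro y y' hy
    exact hS.eq_of_shift_eq ht (hr _) hy (hr' _)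
  let L : E →ₗ[ℂ] E :=
    { toFun := r
      map_add' := fun x y => by
        have h := uniq (S.graph.add_mem (hr x) (hr y))
        have e : (r' x + r' y) + ((t : ℂ) * I) • (r x + r y) = x + y := by
          conv_rhs => rw [← hr' x, ← hr' y]
          module
        rw [← h]; congr 1; exact e.symm
      map_smul' := fun c x => by
        have h := uniq (S.graph.smul_mem c (hr x))
        have e : c • r' x + ((t : ℂ) * I) • (c • r x) = c • x := by
          conv_rhs => rw [← hr' x]
          module
        rw [RingHom.id_apply]
        change _ = c • r x at h
        rw [← h]; congr 1; exact e.symm }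
  refine ⟨L.mkContinuous (1 / |t|) fun x => ?_, fun z => ?_⟩
  · have := hS.abs_mul_norm_le (hr x) t
    rw [hr'] at this
    rw [one_div, inv_mul_eq_div, le_div_iff₀ (abs_pos.2 ht), mul_comm]
    exact this
  · have : (r z, z - ((t : ℂ) * I) • r z) ∈ S.graph := by
      rw [show z - ((t : ℂ) * I) • r z = r' z by rw [sub_eq_iff_eq_add]; exact (hr' z).symm]
      exact hr z
    exact this

/-- The resolvent `(S + i t)⁻¹`. -/
noncomputable def res (hS : IsSymmSurj A S) (t : ℝ) : E →L[ℂ] E :=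
  if ht : t ≠ 0 then (hS.exists_resolvent ht).choose else 0

theorem res_mem (hS : IsSymmSurj A S) {t : ℝ} (ht : t ≠ 0) (z : E) :
    (hS.res t z, z - ((t : ℂ) * I) • hS.res t z) ∈ S.graph := by
  rw [res, dif_pos ht]
  exact (hS.exists_resolvent ht).choose_spec z

theorem res_eq (hS : IsSymmSurj A S) {t : ℝ} (ht : t ≠ 0) {y y' : E} (hy : (y, y') ∈ S.graph) :
    hS.res t (y' + ((t : ℂ) * I) • y) = y :=
  hS.eq_of_shift_eq ht (hS.res_mem ht _) hy (by module)

theorem abs_mul_norm_res_le (hS : IsSymmSurj A S) {t : ℝ} (ht : t ≠ 0) (z : E) :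
    |t| * ‖hS.res t z‖ ≤ ‖z‖ := by
  simpa using hS.abs_mul_norm_le (hS.res_mem ht z) t

theorem norm_sub_res_le (hS : IsSymmSurj A S) {t : ℝ} (ht : t ≠ 0) (z : E) :
    ‖z - ((t : ℂ) * I) • hS.res t z‖ ≤ ‖z‖ := by
  simpa using hS.norm_le (hS.res_mem ht z) t

/-- Maximality of `S`: solve `(S + i)p = z + iy`. Testing against the range of `S - i`, which is
everything, gives `p = y`. -/
theorem mem_graph_of_adjoint (hS : IsSymmSurj A S) {y z : E}
    (h : ∀ u v, (u, v) ∈ S.graph → inner A v y = inner A u z) : (y, z) ∈ S.graph := by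
  obtain ⟨p, p', hp, hpz⟩ := hS.surj 1 one_ne_zero (z + ((1 : ℝ) * I : ℂ) • y)
  have hw : ∀ w, inner A w p = inner A w y := by
    intro w
    obtain ⟨u, v, huv, hw⟩ := hS.surj (-1) (by norm_num) w
    have h1 := h u v huv
    have h2 := hS.symm huv hp
    have hp' : p' = z + I • y - I • p := by
      rw [eq_sub_iff_add_eq]; simpa using hpz
    have hw' : w = v - I • u := by rw [← hw]; simp [sub_eq_add_neg]
    rw [hp'] at h2
    rw [hw']
    simp only [CStarModule.inner_sub_left, CStarModule.inner_sub_right,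
      CStarModule.inner_add_right, CStarModule.inner_smul_left_complex,
      CStarModule.inner_smul_right_complex] at h2 ⊢
    rw [h1, h2]
    have : star I = -I := by simp
    rw [this]
    module
  have e : p = y := inner_ext A hw
  subst e
  have : p' = z := add_right_cancel hpz
  rwa [← this]

theorem isClosed_graph (hS : IsSymmSurj A S) : IsClosed (S.graph : Set (E × E)) := by
  refine IsSeqClosed.isClosed fun z x hz hx => ?_
  refine hS.mem_graph_of_adjoint (y := x.1) (z := x.2) fun u v huv => ?_
  have h1 : Tendsto (fun n => inner A v (z n).1) atTop (𝓝 (inner A v x.1)) :=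
    tendsto_inner A tendsto_const_nhds ((continuous_fst.tendsto x).comp hx)
  have h2 : Tendsto (fun n => inner A u (z n).2) atTop (𝓝 (inner A u x.2)) :=
    tendsto_inner A tendsto_const_nhds ((continuous_snd.tendsto x).comp hx)
  refine tendsto_nhds_unique h1 (h2.congr fun n => (hS.symm huv ?_).symm)
  exact hz n

theorem mem_graph_of_tendsto (hS : IsSymmSurj A S) {x x' : ℕ → E} {y y' : E}
    (h : ∀ n, (x n, x' n) ∈ S.graph) (hx : Tendsto x atTop (𝓝 y))
    (hx' : Tendsto x' atTop (𝓝 y')) : (y, y') ∈ S.graph :=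
  hS.isClosed_graph.mem_of_tendsto (hx.prodMk_nhds hx') (Eventually.of_forall h)

/-- `S (S + i τ)⁻¹` tends strongly to zero as `|τ| → ∞`. -/
theorem tendsto_sub_res (hS : IsSymmSurj A S) {τ : ℕ → ℝ} (hτ0 : ∀ n, τ n ≠ 0)
    (hτ : Tendsto (fun n => |τ n|) atTop atTop) (x : E) :
    Tendsto (fun n => x - ((τ n : ℂ) * I) • hS.res (τ n) x) atTop (𝓝 0) := by
  rw [Metric.tendsto_atTop]
  intro ε hε
  obtain ⟨w, hw, hwd⟩ := hS.dense.exists_dist_lt x (half_pos hε)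
  obtain ⟨w', hw'⟩ := LinearPMap.mem_domain_iff.1 hw
  obtain ⟨N, hN⟩ := eventually_atTop.1 (hτ.eventually_gt_atTop (‖w'‖ / (ε / 2)))
  refine ⟨N, fun n hn => ?_⟩
  rw [dist_zero_right]
  have h1 : ‖(x - w) - ((τ n : ℂ) * I) • hS.res (τ n) (x - w)‖ < ε / 2 :=
    (hS.norm_sub_res_le (hτ0 n) _).trans_lt (by rwa [← dist_eq_norm])
  -- On `D(S)`, `S(S + iτ)⁻¹w = (S + iτ)⁻¹Sw` has norm at most `‖Sw‖/|τ|`; density and contractivity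
  -- give the rest.
  have h2 : w - ((τ n : ℂ) * I) • hS.res (τ n) w = hS.res (τ n) w' := by
    have := hS.res_eq (hτ0 n) hw'
    rw [map_add, map_smul] at this
    conv_lhs => enter [1]; rw [← this]
    abel
  have h3 : ‖w - ((τ n : ℂ) * I) • hS.res (τ n) w‖ < ε / 2 := by
    rw [h2]
    have hp : 0 < |τ n| := abs_pos.2 (hτ0 n)
    refine lt_of_mul_lt_mul_left ?_ hp.le
    refine (hS.abs_mul_norm_res_le (hτ0 n) w').trans_lt ?_
    have := hN n hn
    rwa [div_lt_iff₀ (by positivity)] at this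
  have e : x - ((τ n : ℂ) * I) • hS.res (τ n) x =
      ((x - w) - ((τ n : ℂ) * I) • hS.res (τ n) (x - w)) +
        (w - ((τ n : ℂ) * I) • hS.res (τ n) w) := by
    rw [map_sub]; module
  rw [e]
  linarith [norm_add_le ((x - w) - ((τ n : ℂ) * I) • hS.res (τ n) (x - w))
    (w - ((τ n : ℂ) * I) • hS.res (τ n) w)]

end IsSymmSurj

theorem mem_graph_add_iff {x z : E} :
    (x, z) ∈ (S + T).graph ↔ ∃ s t, (x, s) ∈ S.graph ∧ (x, t) ∈ T.graph ∧ s + t = z := by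
  constructor
  · intro h
    obtain ⟨⟨y, hy⟩, hyx, hyz⟩ := (LinearPMap.mem_graph_iff _).1 h
    simp only at hyx hyz
    subst hyx
    exact ⟨S ⟨y, hy.1⟩, T ⟨y, hy.2⟩, S.mem_graph ⟨y, hy.1⟩, T.mem_graph ⟨y, hy.2⟩, hyz⟩
  · rintro ⟨s, t, hs, ht, rfl⟩
    obtain ⟨⟨y, hy⟩, hyx, hys⟩ := (LinearPMap.mem_graph_iff _).1 hs
    obtain ⟨⟨y', hy'⟩, hyx', hyt⟩ := (LinearPMap.mem_graph_iff _).1 ht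
    simp only at hyx hys hyx' hyt
    subst hyx hyx'
    rw [LinearPMap.mem_graph_iff]
    exact ⟨⟨y', hy, hy'⟩, rfl, by rw [LinearPMap.add_apply, ← hys, ← hyt]⟩

theorem mem_graph_smul {c : ℂ} {x s : E} (h : (x, s) ∈ S.graph) :
    (x, c • s) ∈ (c • S).graph := by
  obtain ⟨⟨y, hy⟩, hyx, hys⟩ := (LinearPMap.mem_graph_iff _).1 h
  simp only at hyx hys
  subst hyx hys
  exact (c • S).mem_graph ⟨y, hy⟩

theorem exists_of_mem_graph_smul {c : ℂ} {x s : E} (h : (x, s) ∈ (c • S).graph) :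
    ∃ r, (x, r) ∈ S.graph ∧ s = c • r := by
  obtain ⟨⟨y, hy⟩, hyx, hys⟩ := (LinearPMap.mem_graph_iff _).1 h
  simp only at hyx hys
  subst hyx hys
  exact ⟨S ⟨y, hy⟩, S.mem_graph ⟨y, hy⟩, rfl⟩

theorem IsSymmSurj.smul (hS : IsSymmSurj A S) {c : ℝ} (hc : c ≠ 0) :
    IsSymmSurj A ((c : ℂ) • S) where
  symm hx hy := by
    obtain ⟨r, hr, rfl⟩ := exists_of_mem_graph_smul hx
    obtain ⟨r', hr', rfl⟩ := exists_of_mem_graph_smul hy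
    simp [hS.symm hr hr']
  surj t ht z := by
    have hc' : (c : ℂ) ≠ 0 := by exact_mod_cast hc
    obtain ⟨x, x', hx, h⟩ := hS.surj (t / c) (div_ne_zero ht hc) ((c : ℂ)⁻¹ • z)
    refine ⟨x, (c : ℂ) • x', mem_graph_smul hx, ?_⟩
    rw [← smul_inv_smul₀ hc' z, ← h, smul_add, smul_smul]
    congr 2
    push_cast
    field_simp
  dense := hS.dense

end Resolvent

/-! ### Anticommuting pairs: invariance under resolvents, the extended anticommutator, coercivity.
-/

section Anticommuting

variable (A : Type*) {E : Type*} [NonUnitalCStarAlgebra A] [PartialOrder A] [StarOrderedRing A]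
  [NormedAddCommGroup E] [NormedSpace ℂ E] [SMul A E] [CStarModule A E]

/-- `x ∈ F(S, T)` with `s = S x`, `t = T x`, `p = S T x` and `q = T S x`. -/
structure AntiData (S T : E →ₗ.[ℂ] E) (x s t p q : E) : Prop where
  left : (x, s) ∈ S.graph
  right : (x, t) ∈ T.graph
  left_right : (t, p) ∈ S.graph
  right_left : (s, q) ∈ T.graph

/-- The form estimate on the anticommutator, with a common constant. -/
structure FormEstimate (S T : E →ₗ.[ℂ] E) (C : ℝ) : Prop where
  pos : 0 < C
  le : ∀ {x s t p q : E}, AntiData S T x s t p q →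
    inner A (p + q) (p + q) ≤ C • (inner A x x + inner A s s + inner A t t)

variable {A} {S T : E →ₗ.[ℂ] E}

namespace AntiData

variable {x s t p q x' s' t' p' q' : E}

theorem add (h : AntiData S T x s t p q) (h' : AntiData S T x' s' t' p' q') :
    AntiData S T (x + x') (s + s') (t + t') (p + p') (q + q') :=
  ⟨S.graph.add_mem h.1 h'.1, T.graph.add_mem h.2 h'.2, S.graph.add_mem h.3 h'.3,
    T.graph.add_mem h.4 h'.4⟩

theorem sub (h : AntiData S T x s t p q) (h' : AntiData S T x' s' t' p' q') :
    AntiData S T (x - x') (s - s') (t - t') (p - p') (q - q') :=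
  ⟨S.graph.sub_mem h.1 h'.1, T.graph.sub_mem h.2 h'.2, S.graph.sub_mem h.3 h'.3,
    T.graph.sub_mem h.4 h'.4⟩

theorem smul (c : ℂ) (h : AntiData S T x s t p q) :
    AntiData S T (c • x) (c • s) (c • t) (c • p) (c • q) :=
  ⟨S.graph.smul_mem c h.1, T.graph.smul_mem c h.2, S.graph.smul_mem c h.3,
    T.graph.smul_mem c h.4⟩

theorem symm (h : AntiData S T x s t p q) : AntiData T S x t s q p :=
  ⟨h.2, h.1, h.4, h.3⟩

theorem inner_anticommutator (hS : IsSymmSurj A S) (hT : IsSymmSurj A T)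
    (h : AntiData S T x s t p q) {u v w : E} (hv : (u, v) ∈ S.graph) (hw : (u, w) ∈ T.graph) :
    inner A (p + q) u = inner A t v + inner A s w := by
  rw [CStarModule.inner_add_left, hS.symm h.left_right hv, hT.symm h.right_left hw]

end AntiData

theorem FormEstimate.symm {C : ℝ} (h : FormEstimate A S T C) : FormEstimate A T S C where
  pos := h.pos
  le hd := by
    have := h.le hd.symm
    rw [add_comm, add_right_comm]
    exact this

theorem norm_le_of_inner_le {C : ℝ} (hC : 0 ≤ C) {h x s t : E}
    (hle : inner A h h ≤ C • (inner A x x + inner A s s + inner A t t)) :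
    ‖h‖ ≤ √C * (‖x‖ + ‖s‖ + ‖t‖) := by
  have h1 := norm_sq_le_of_inner_le A hle
  rw [norm_smul, Real.norm_of_nonneg hC] at h1
  have h2 : ‖inner A x x + inner A s s + inner A t t‖ ≤ ‖x‖ ^ 2 + ‖s‖ ^ 2 + ‖t‖ ^ 2 := by
    refine norm_add₃_le.trans ?_
    simp only [norm_inner_self, le_refl]
  refine le_of_sq_le_sq ?_ (by positivity)
  rw [mul_pow, Real.sq_sqrt hC]
  refine h1.trans ?_
  gcongr
  refine h2.trans ?_
  nlinarith [norm_nonneg x, norm_nonneg s, norm_nonneg t,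
    mul_nonneg (norm_nonneg x) (norm_nonneg s), mul_nonneg (norm_nonneg x) (norm_nonneg t),
    mul_nonneg (norm_nonneg s) (norm_nonneg t)]

theorem FormEstimate.norm_le {C : ℝ} (hE : FormEstimate A S T C) {x s t p q : E}
    (h : AntiData S T x s t p q) : ‖p + q‖ ≤ √C * (‖x‖ + ‖s‖ + ‖t‖) :=
  norm_le_of_inner_le hE.pos.le (hE.le h)

/-- All `(x, T x)` for which `(S + i τ)⁻¹ x` belongs to `F(S, T)`. -/
def resolventGraph (S T : E →ₗ.[ℂ] E) (τ : ℝ) : Submodule ℂ (E × E) where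
  carrier := {z | z ∈ T.graph ∧
    ∃ y s t p q, AntiData S T y s t p q ∧ s + ((τ : ℂ) * I) • y = z.1}
  zero_mem' := ⟨T.graph.zero_mem, 0, 0, 0, 0, 0,
    ⟨S.graph.zero_mem, T.graph.zero_mem, S.graph.zero_mem, T.graph.zero_mem⟩, by simp⟩
  add_mem' := by
    rintro z z' ⟨hz, y, s, t, p, q, h, e⟩ ⟨hz', y', s', t', p', q', h', e'⟩
    refine ⟨T.graph.add_mem hz hz', _, _, _, _, _, h.add h', ?_⟩
    rw [Prod.fst_add, ← e, ← e']; module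
  smul_mem' := by
    rintro c z ⟨hz, y, s, t, p, q, h, e⟩
    refine ⟨T.graph.smul_mem c hz, _, _, _, _, _, h.smul c, ?_⟩
    rw [Prod.smul_fst, ← e]; module

/-- `(S + i τ)⁻¹ (D(T)) ⊆ F(S, T)` for all real `τ` with `|τ| ≥ l`. -/
def ResolventMapsDomain (S T : E →ₗ.[ℂ] E) (l : ℝ) : Prop :=
  ∀ τ : ℝ, l ≤ |τ| → T.graph ≤ resolventGraph S T τ

theorem AntiData.shift_eq {y s t p q x x' : E} {τ : ℝ} (h : AntiData S T y s t p q)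
    (hx : s + ((τ : ℂ) * I) • y = x) (hx' : (x, x') ∈ T.graph) :
    x' = q + ((τ : ℂ) * I) • t := by
  have := T.graph.add_mem h.right_left (T.graph.smul_mem ((τ : ℂ) * I) h.right)
  subst hx
  exact T.mem_graph_snd_inj hx' this rfl

/-- The basic identity `(S - iτ)Ty = [S,T]y - Tx` with `x = (S + iτ)y`. The sign of `τ` flips
because `S` and `T` anticommute up to the bounded-type error `p + q`. -/
theorem AntiData.shift_eq' {y s t p q x x' : E} {τ : ℝ} (h : AntiData S T y s t p q)
    (hx : s + ((τ : ℂ) * I) • y = x) (hx' : (x, x') ∈ T.graph) :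
    p + (((-τ : ℝ) : ℂ) * I) • t = (p + q) - x' := by
  rw [h.shift_eq hx hx']; push_cast; module

theorem AntiData.abs_mul_norm_le (hS : IsSymmSurj A S) {y s t p q x x' : E} {τ : ℝ}
    (h : AntiData S T y s t p q) (hx : s + ((τ : ℂ) * I) • y = x) (hx' : (x, x') ∈ T.graph) :
    |τ| * ‖t‖ ≤ ‖p + q‖ + ‖x'‖ := by
  have := hS.abs_mul_norm_le h.left_right (-τ)
  rw [h.shift_eq' hx hx', abs_neg] at this
  exact this.trans (norm_sub_le _ _)

/-- The form bound contains `√C‖Ty‖`, which for `|τ| ≥ 2√C` is at most half of `‖p + q‖ + ‖x'‖` and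
is absorbed. -/
theorem AntiData.norm_anticommutator_le (hS : IsSymmSurj A S) {C : ℝ}
    (hE : FormEstimate A S T C) {y s t p q x x' : E} {τ : ℝ}
    (hτ : 2 * √C ≤ |τ|) (hτ1 : 1 ≤ |τ|)
    (h : AntiData S T y s t p q) (hx : s + ((τ : ℂ) * I) • y = x) (hx' : (x, x') ∈ T.graph) :
    ‖p + q‖ ≤ 4 * √C * ‖x‖ + ‖x'‖ := by
  have h1 := hE.norm_le h
  have h2 := h.abs_mul_norm_le hS hx hx'
  have h3 := hS.abs_mul_norm_le h.left τ
  have h4 := hS.norm_le h.left τ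
  rw [hx] at h3 h4
  have hM : 0 ≤ √C := Real.sqrt_nonneg C
  have h5 : ‖y‖ ≤ ‖x‖ := by nlinarith [norm_nonneg y]
  have h6 : 2 * √C * ‖t‖ ≤ |τ| * ‖t‖ := by gcongr
  have h7 : √C * ‖y‖ ≤ √C * ‖x‖ := by gcongr
  have h8 : √C * ‖s‖ ≤ √C * ‖x‖ := by gcongr
  linarith

theorem cauchySeq_of_norm_sub_le {F G : Type*} [NormedAddCommGroup F] [NormedAddCommGroup G]
    {z : ℕ → F} {h : ℕ → G} (hz : CauchySeq z) (K : ℝ)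
    (hK : ∀ m n, ‖h m - h n‖ ≤ K * ‖z m - z n‖) : CauchySeq h := by
  rw [Metric.cauchySeq_iff] at hz ⊢
  intro ε hε
  obtain ⟨N, hN⟩ := hz (ε / (|K| + 1)) (by positivity)
  refine ⟨N, fun m hm n hn => ?_⟩
  have h1 := hN m hm n hn
  rw [dist_eq_norm, lt_div_iff₀ (by positivity)] at h1
  rw [dist_eq_norm]
  refine lt_of_le_of_lt ((hK m n).trans ?_) h1
  nlinarith [norm_nonneg (z m - z n), le_abs_self K]

variable [CompleteSpace E]

/-- Along a sequence converging in the graph norm of `T`, the vectors `y`, `Ty` and `[S,T]y` are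
Lipschitz in `(x, Tx)`. The limits of `Sy`, `TSy` and `STy` are then forced, and closedness of `S`
and `T` applies. -/
theorem isClosed_resolventGraph (hS : IsSymmSurj A S) (hT : IsSymmSurj A T) {C : ℝ}
    (hE : FormEstimate A S T C) {τ : ℝ} (hτ : 2 * √C ≤ |τ|) (hτ1 : 1 ≤ |τ|) :
    IsClosed (resolventGraph S T τ : Set (E × E)) := by
  refine IsSeqClosed.isClosed fun z x hz hx => ?_
  choose hzT y s t p q h hy using hz
  have hx1 : Tendsto (fun n => (z n).1) atTop (𝓝 x.1) := (continuous_fst.tendsto x).comp hx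
  have hx2 : Tendsto (fun n => (z n).2) atTop (𝓝 x.2) := (continuous_snd.tendsto x).comp hx
  have hsub : ∀ m n, (s m - s n) + ((τ : ℂ) * I) • (y m - y n) = (z m - z n).1 := fun m n => by
    rw [Prod.fst_sub, ← hy, ← hy]; module
  have hzsub : ∀ m n, ((z m - z n).1, (z m - z n).2) ∈ T.graph := fun m n =>
    T.graph.sub_mem (hzT m) (hzT n)
  have hM : 0 ≤ √C := Real.sqrt_nonneg C
  have hh : ∀ m n, ‖(p m + q m) - (p n + q n)‖ ≤ (4 * √C + 1) * ‖z m - z n‖ := fun m n => by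
    have := ((h m).sub (h n)).norm_anticommutator_le hS hE hτ hτ1 (hsub m n) (hzsub m n)
    have e : (p m + q m) - (p n + q n) = (p m - p n) + (q m - q n) := by abel
    rw [e]
    refine this.trans ?_
    have h1 := norm_fst_le (z m - z n)
    have h2 := norm_snd_le (z m - z n)
    have : 4 * √C * ‖(z m - z n).1‖ ≤ 4 * √C * ‖z m - z n‖ := by gcongr
    linarith
  have ht : ∀ m n, ‖t m - t n‖ ≤ (4 * √C + 2) * ‖z m - z n‖ := fun m n => by
    have h1 := ((h m).sub (h n)).abs_mul_norm_le hS (hsub m n) (hzsub m n)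
    have e : (p m - p n) + (q m - q n) = (p m + q m) - (p n + q n) := by abel
    rw [e] at h1
    have h2 := norm_snd_le (z m - z n)
    have h3 := hh m n
    nlinarith [norm_nonneg (t m - t n)]
  have hyc : ∀ m n, ‖y m - y n‖ ≤ 1 * ‖z m - z n‖ := fun m n => by
    have h1 := hS.abs_mul_norm_le ((h m).sub (h n)).left τ
    rw [hsub] at h1
    have h2 := norm_fst_le (z m - z n)
    nlinarith [norm_nonneg (y m - y n)]
  obtain ⟨y₀, hy₀⟩ := cauchySeq_tendsto_of_complete (cauchySeq_of_norm_sub_le hx.cauchySeq _ hyc)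
  obtain ⟨t₀, ht₀⟩ := cauchySeq_tendsto_of_complete (cauchySeq_of_norm_sub_le hx.cauchySeq _ ht)
  obtain ⟨h₀, hh₀⟩ := cauchySeq_tendsto_of_complete (cauchySeq_of_norm_sub_le hx.cauchySeq _ hh)
  have hs₀ : Tendsto s atTop (𝓝 (x.1 - ((τ : ℂ) * I) • y₀)) :=
    (hx1.sub (hy₀.const_smul ((τ : ℂ) * I))).congr fun n => by rw [← hy n]; abel
  have hq₀ : Tendsto q atTop (𝓝 (x.2 - ((τ : ℂ) * I) • t₀)) :=
    (hx2.sub (ht₀.const_smul ((τ : ℂ) * I))).congr fun n => by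
      rw [(h n).shift_eq (hy n) (hzT n)]; abel
  have hp₀ : Tendsto p atTop (𝓝 (h₀ - (x.2 - ((τ : ℂ) * I) • t₀))) :=
    (hh₀.sub hq₀).congr fun n => by abel
  exact ⟨hT.mem_graph_of_tendsto hzT hx1 hx2, y₀, _, t₀, _, _,
    ⟨hS.mem_graph_of_tendsto (fun n => (h n).left) hy₀ hs₀,
      hT.mem_graph_of_tendsto (fun n => (h n).right) hy₀ ht₀,
      hS.mem_graph_of_tendsto (fun n => (h n).left_right) ht₀ hp₀,
      hT.mem_graph_of_tendsto (fun n => (h n).right_left) hs₀ hq₀⟩, by abel⟩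

/-- The regularization `i τ (S + i τ)⁻¹ x` of `x ∈ D(T)` converges to `x` in the graph norm
of `T` as `|τ| → ∞`. -/
theorem AntiData.tendsto_right (hS : IsSymmSurj A S) {C : ℝ}
    (hE : FormEstimate A S T C) {τ : ℕ → ℝ} (hτ0 : ∀ n, 2 * √C ≤ |τ n|) (hτ1 : ∀ n, 1 ≤ |τ n|)
    (hτ : Tendsto (fun n => |τ n|) atTop atTop) {x x' : E} (hx : (x, x') ∈ T.graph)
    {y s t p q : ℕ → E} (h : ∀ n, AntiData S T (y n) (s n) (t n) (p n) (q n))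
    (hy : ∀ n, s n + ((τ n : ℂ) * I) • y n = x) :
    Tendsto (fun n => ((τ n : ℂ) * I) • t n) atTop (𝓝 x') := by
  have hne : ∀ n, τ n ≠ 0 := fun n => abs_pos.1 (zero_lt_one.trans_le (hτ1 n))
  have hne' : ∀ n, -τ n ≠ 0 := fun n => neg_ne_zero.2 (hne n)
  have hM : 0 ≤ √C := Real.sqrt_nonneg C
  have hinv : Tendsto (fun n => |τ n|⁻¹) atTop (𝓝 0) := tendsto_inv_atTop_zero.comp hτ
  have hyr : ∀ n, y n = hS.res (τ n) x := fun n => by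
    rw [← hy n, hS.res_eq (hne n) (h n).left]
  have htr : ∀ n, t n = hS.res (-τ n) ((p n + q n) - x') := fun n => by
    rw [← (h n).shift_eq' (hy n) hx, hS.res_eq (hne' n) (h n).left_right]
  have hs : Tendsto s atTop (𝓝 0) := by
    refine (hS.tendsto_sub_res hne hτ x).congr fun n => ?_
    rw [← hyr, ← hy n]; abel
  have hty : Tendsto (fun n => ‖y n‖) atTop (𝓝 0) := by
    refine squeeze_zero (fun n => norm_nonneg _) (fun n => ?_)
      (by simpa using hinv.mul_const ‖x‖)
    have := hS.abs_mul_norm_res_le (hne n) x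
    rw [← hyr, ← le_inv_mul_iff₀ (abs_pos.2 (hne n))] at this
    exact this
  have htt : Tendsto (fun n => ‖t n‖) atTop (𝓝 0) := by
    refine squeeze_zero (fun n => norm_nonneg _) (fun n => ?_)
      (by simpa using hinv.mul_const (4 * √C * ‖x‖ + ‖x'‖ + ‖x'‖))
    rw [le_inv_mul_iff₀ (abs_pos.2 (hne n))]
    refine ((h n).abs_mul_norm_le hS (hy n) hx).trans ?_
    gcongr
    exact (h n).norm_anticommutator_le hS hE (hτ0 n) (hτ1 n) (hy n) hx
  have hh : Tendsto (fun n => ‖p n + q n‖) atTop (𝓝 0) := by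
    refine squeeze_zero (fun n => norm_nonneg _) (fun n => hE.norm_le (h n)) ?_
    simpa using ((hty.add hs.norm).add htt).const_mul (√C)
  have hτneg : Tendsto (fun n => |-τ n|) atTop atTop := by simpa only [abs_neg] using hτ
  have h1 : Tendsto (fun n => (((-τ n : ℝ) : ℂ) * I) • hS.res (-τ n) (p n + q n)) atTop
      (𝓝 0) := by
    refine squeeze_zero_norm (fun n => ?_) hh
    have := hS.abs_mul_norm_res_le (hne' n) (p n + q n)
    rwa [norm_smul, norm_mul, norm_I, mul_one, norm_real, Real.norm_eq_abs]
  have h2 : Tendsto (fun n => (((-τ n : ℝ) : ℂ) * I) • hS.res (-τ n) x') atTop (𝓝 x') := by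
    simpa using (tendsto_const_nhds (x := x')).sub (hS.tendsto_sub_res hne' hτneg x')
  -- By the basic identity, `iτTy = -iτ(S - iτ)⁻¹(Tx - [S,T]y)`. The first part tends to `x'`; the
  -- second vanishes since the form bound sends `[S,T]y` to zero along with `y`, `Sy`, `Ty`.
  have h3 := h2.sub h1
  rw [sub_zero] at h3
  refine h3.congr fun n => ?_
  conv_rhs => rw [htr n, map_sub]
  push_cast
  module

/-- `F(S, T)` approximates `D(T)` in the graph norm of `T`, and `D(S) ∩ D(T)` in both graph
norms. -/
theorem exists_antiData_tendsto (hS : IsSymmSurj A S) {C l : ℝ}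
    (hE : FormEstimate A S T C) (hR : ResolventMapsDomain S T l) {x x' : E}
    (hx : (x, x') ∈ T.graph) :
    ∃ y s t p q : ℕ → E, (∀ n, AntiData S T (y n) (s n) (t n) (p n) (q n)) ∧
      Tendsto y atTop (𝓝 x) ∧ Tendsto t atTop (𝓝 x') ∧
      ∀ x'', (x, x'') ∈ S.graph → Tendsto s atTop (𝓝 x'') := by
  have hM : 0 ≤ √C := Real.sqrt_nonneg C
  set τ : ℕ → ℝ := fun n => n + (|l| + 2 * √C + 1) with hτdef
  have hpos : ∀ n, 0 < τ n := fun n => by positivity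
  have habs : ∀ n, |τ n| = τ n := fun n => abs_of_pos (hpos n)
  have hn0 : ∀ n : ℕ, (0 : ℝ) ≤ n := fun n => n.cast_nonneg
  have hl : ∀ n, l ≤ |τ n| := fun n => by
    rw [habs]; simp only [hτdef]; linarith [le_abs_self l, hn0 n]
  have hτ0 : ∀ n, 2 * √C ≤ |τ n| := fun n => by
    rw [habs]; simp only [hτdef]; linarith [abs_nonneg l, hn0 n]
  have hτ1 : ∀ n, 1 ≤ |τ n| := fun n => by
    rw [habs]; simp only [hτdef]; linarith [abs_nonneg l, hn0 n]
  have hτ : Tendsto (fun n => |τ n|) atTop atTop := by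
    simp only [habs]
    exact tendsto_atTop_add_const_right _ _ tendsto_natCast_atTop_atTop
  have hne : ∀ n, τ n ≠ 0 := fun n => (hpos n).ne'
  choose y s t p q h hy using fun n => (hR (τ n) (hl n) hx).2
  replace hy : ∀ n, s n + ((τ n : ℂ) * I) • y n = x := hy
  have hyr : ∀ n, y n = hS.res (τ n) x := fun n => by
    rw [← hy n, hS.res_eq (hne n) (h n).left]
  refine ⟨_, _, _, _, _, fun n => (h n).smul ((τ n : ℂ) * I), ?_, ?_, fun x'' hx'' => ?_⟩
  · simpa [hyr] using (tendsto_const_nhds (x := x)).sub (hS.tendsto_sub_res hne hτ x)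
  · exact AntiData.tendsto_right hS hE hτ0 hτ1 hτ hx h hy
  · have h1 : ∀ n, s n = hS.res (τ n) x'' := fun n => by
      have := hS.res_eq (hne n) hx''
      rw [map_add, map_smul, ← hyr] at this
      exact add_right_cancel ((hy n).trans this.symm)
    simpa [h1] using (tendsto_const_nhds (x := x'')).sub (hS.tendsto_sub_res hne hτ x'')

/-- For `x ∈ D(T)` the vectors `iτ(S + iτ)⁻¹x` lie in both domains and tend to `x`. -/
theorem dense_domain_add (hS : IsSymmSurj A S) (hT : Dense (T.domain : Set E)) {l : ℝ}
    (hR : ResolventMapsDomain S T l) : Dense ((S + T).domain : Set E) := by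
  refine dense_iff_closure_eq.2 (Set.eq_univ_of_univ_subset ?_)
  rw [← hT.closure_eq]
  refine closure_minimal (fun x hx => ?_) isClosed_closure
  obtain ⟨x', hx'⟩ := LinearPMap.mem_domain_iff.1 hx
  set τ : ℕ → ℝ := fun n => n + (|l| + 1) with hτdef
  have hpos : ∀ n, 0 < τ n := fun n => by positivity
  have habs : ∀ n, |τ n| = τ n := fun n => abs_of_pos (hpos n)
  have hne : ∀ n, τ n ≠ 0 := fun n => (hpos n).ne'
  have hτ : Tendsto (fun n => |τ n|) atTop atTop := by
    simp only [habs]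
    exact tendsto_atTop_add_const_right _ _ tendsto_natCast_atTop_atTop
  have hlim : Tendsto (fun n => ((τ n : ℂ) * I) • hS.res (τ n) x) atTop (𝓝 x) := by
    simpa using (tendsto_const_nhds (x := x)).sub (hS.tendsto_sub_res hne hτ x)
  refine mem_closure_of_tendsto hlim (Eventually.of_forall fun n => ?_)
  have hl : l ≤ |τ n| := by
    rw [habs]; simp only [hτdef]; linarith [le_abs_self l, n.cast_nonneg (α := ℝ)]
  obtain ⟨-, y, s, t, p, q, h, hy⟩ := hR (τ n) hl hx'
  have hyr : y = hS.res (τ n) x := by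
    rw [← hS.res_eq (hne n) h.left, hy]
  rw [← hyr]
  exact (S + T).domain.smul_mem _ ⟨LinearPMap.mem_domain_of_mem_graph h.left,
    LinearPMap.mem_domain_of_mem_graph h.right⟩

/-- The anticommutator extends to `D(S) ∩ D(T)`. -/
theorem exists_extended_anticommutator (hS : IsSymmSurj A S) (hT : IsSymmSurj A T) {C l : ℝ}
    (hE : FormEstimate A S T C) (hR : ResolventMapsDomain S T l) {x s t : E}
    (hs : (x, s) ∈ S.graph) (ht : (x, t) ∈ T.graph) :
    ∃ h : E, inner A h h ≤ C • (inner A x x + inner A s s + inner A t t) ∧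
      ∀ u v w, (u, v) ∈ S.graph → (u, w) ∈ T.graph →
        inner A h u = inner A t v + inner A s w := by
  obtain ⟨y, s', t', p, q, h, hy, ht', hs'⟩ := exists_antiData_tendsto hS hE hR ht
  have hs' := hs' s hs
  have hc : CauchySeq fun n => (y n, s' n, t' n) :=
    (hy.prodMk_nhds (hs'.prodMk_nhds ht')).cauchySeq
  have hb : ∀ m n, ‖(p m + q m) - (p n + q n)‖ ≤
      (√C * 3) * ‖(y m, s' m, t' m) - (y n, s' n, t' n)‖ := fun m n => by
    have h1 := hE.norm_le ((h m).sub (h n))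
    have e : (p m + q m) - (p n + q n) = (p m - p n) + (q m - q n) := by abel
    rw [e, mul_assoc]
    refine h1.trans ?_
    gcongr
    set z := (y m, s' m, t' m) - (y n, s' n, t' n) with hz
    have a1 : ‖y m - y n‖ ≤ ‖z‖ := norm_fst_le z
    have a2 : ‖s' m - s' n‖ ≤ ‖z‖ := (norm_fst_le z.2).trans (norm_snd_le z)
    have a3 : ‖t' m - t' n‖ ≤ ‖z‖ := (norm_snd_le z.2).trans (norm_snd_le z)
    linarith
  obtain ⟨h₀, hh₀⟩ := cauchySeq_tendsto_of_complete (cauchySeq_of_norm_sub_le hc _ hb)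
  refine ⟨h₀, ?_, fun u v w hv hw => ?_⟩
  · refine le_of_tendsto_of_tendsto' (tendsto_inner A hh₀ hh₀)
      ((((tendsto_inner A hy hy).add (tendsto_inner A hs' hs')).add
        (tendsto_inner A ht' ht')).const_smul C) fun n => hE.le (h n)
  · refine tendsto_nhds_unique (tendsto_inner A hh₀ (tendsto_const_nhds (x := u))) ?_
    refine ((tendsto_inner A ht' tendsto_const_nhds).add
      (tendsto_inner A hs' tendsto_const_nhds)).congr fun n => ?_
    exact ((h n).inner_anticommutator hS hT hv hw).symm

/-- The cross terms of `⟨s + t, s + t⟩` add up to `⟨h, x⟩` with `h` the extended anticommutator.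
Positivity of `C⁻¹⟨h + Cx, h + Cx⟩` and the form bound on `h` cost only half of `⟨s, s⟩ + ⟨t, t⟩`.
-/
theorem coercive (hS : IsSymmSurj A S) (hT : IsSymmSurj A T) {C l : ℝ}
    (hE : FormEstimate A S T C) (hR : ResolventMapsDomain S T l) {x s t : E}
    (hs : (x, s) ∈ S.graph) (ht : (x, t) ∈ T.graph) :
    inner A s s + inner A t t ≤ (2 : ℝ) • inner A (s + t) (s + t) + (1 + C) • inner A x x := by
  obtain ⟨h, hle, hh⟩ := exists_extended_anticommutator hS hT hE hR hs ht
  have hx := hh x s t hs ht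
  have hC := hE.pos
  have hxh : inner A x h = inner A h x := by
    rw [← CStarModule.star_inner h x, hx, star_add, CStarModule.star_inner,
      CStarModule.star_inner, add_comm]
  have h0 : (0 : A) ≤ inner A (h + C • x) (h + C • x) := CStarModule.inner_self_nonneg
  simp only [CStarModule.inner_add_left, CStarModule.inner_add_right,
    CStarModule.inner_smul_left_real, CStarModule.inner_smul_right_real, hxh] at h0
  have h1 := smul_nonneg (inv_nonneg.2 hC.le) (add_nonneg h0 (sub_nonneg.2 hle))
  rw [← sub_nonneg]
  convert h1 using 1
  simp only [CStarModule.inner_add_left, CStarModule.inner_add_right]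
  have h2 : inner A s t = inner A h x - inner A t s := by rw [hx]; abel
  rw [h2]
  match_scalars <;> field_simp <;> ring

theorem norm_sq_le_of_coercive (hS : IsSymmSurj A S) (hT : IsSymmSurj A T) {C l : ℝ}
    (hE : FormEstimate A S T C) (hR : ResolventMapsDomain S T l) {x s t : E}
    (hs : (x, s) ∈ S.graph) (ht : (x, t) ∈ T.graph) :
    ‖s‖ ^ 2 ≤ 2 * ‖s + t‖ ^ 2 + (1 + C) * ‖x‖ ^ 2 := by
  have h1 := (le_add_of_nonneg_right CStarModule.inner_self_nonneg).trans
    (coercive hS hT hE hR hs ht)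
  refine (norm_sq_le_of_inner_le A h1).trans ((norm_add_le _ _).trans ?_)
  have : 0 ≤ 1 + C := by linarith [hE.pos]
  rw [norm_smul, norm_smul, norm_inner_self, norm_inner_self, Real.norm_of_nonneg this]
  simp

end Anticommuting

/-! ### Self-adjointness of the sum by Yosida approximation. -/

section Sum

variable {A : Type*} {E : Type*} [NonUnitalCStarAlgebra A] [PartialOrder A] [StarOrderedRing A]
  [NormedAddCommGroup E] [NormedSpace ℂ E] [SMul A E] [CStarModule A E] [CompleteSpace E]
  {S T : E →ₗ.[ℂ] E}

theorem symm_graph_add (hS : IsSymmSurj A S) (hT : IsSymmSurj A T) {x x' y y' : E}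
    (hx : (x, x') ∈ (S + T).graph) (hy : (y, y') ∈ (S + T).graph) :
    inner A x' y = inner A x y' := by
  obtain ⟨s, t, hs, ht, rfl⟩ := mem_graph_add_iff.1 hx
  obtain ⟨s', t', hs', ht', rfl⟩ := mem_graph_add_iff.1 hy
  rw [CStarModule.inner_add_left, CStarModule.inner_add_right, hS.symm hs hs', hT.symm ht ht']

/-- Since `iτS(S + iτ)⁻¹ = iτ + τ²(S + iτ)⁻¹`, the approximate equation is `(T + i(μ+τ))x + τ²(S +
iτ)⁻¹x = z`. As `μ` and `τ` have the same sign, the perturbation has relative norm at most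
`|τ|/(|μ|+|τ|) < 1`. -/
theorem exists_yosida_solution (hS : IsSymmSurj A S) (hT : IsSymmSurj A T) {l μ τ : ℝ}
    (hR : ResolventMapsDomain S T l) (hμ : μ ≠ 0) (hτ0 : τ ≠ 0) (hl : l ≤ |τ|)
    (hμτ : |μ + τ| = |μ| + |τ|) (z : E) :
    ∃ x x' y s t p q, (x, x') ∈ T.graph ∧ AntiData S T y s t p q ∧
      s + ((τ : ℂ) * I) • y = x ∧
      x' + ((τ : ℂ) * I) • s + ((μ : ℂ) * I) • x = z ∧ |μ| * ‖x‖ ≤ ‖z‖ := by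
  have hμ' : 0 < |μ| := abs_pos.2 hμ
  have hτ' : 0 < |τ| := abs_pos.2 hτ0
  have hm : 0 < |μ + τ| := by rw [hμτ]; positivity
  have hm0 : μ + τ ≠ 0 := abs_pos.1 hm
  set m := μ + τ with hmdef
  set B : E →L[ℂ] E := (τ ^ 2 : ℂ) • (hT.res m).comp (hS.res τ) with hB
  have hBn : ‖-B‖ < 1 := by
    rw [norm_neg]
    refine (B.opNorm_le_bound (M := |τ| / |m|) (by positivity) fun x => ?_).trans_lt ?_
    · have h1 := hT.abs_mul_norm_res_le hm0 (hS.res τ x)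
      have h2 := hS.abs_mul_norm_res_le hτ0 x
      have e : ‖B x‖ = |τ| ^ 2 * ‖hT.res m (hS.res τ x)‖ := by
        rw [hB]; simp [norm_smul]
      rw [e, div_mul_eq_mul_div, le_div_iff₀ hm]
      calc |τ| ^ 2 * ‖hT.res m (hS.res τ x)‖ * |m|
          = |τ| ^ 2 * (|m| * ‖hT.res m (hS.res τ x)‖) := by ring
        _ ≤ |τ| ^ 2 * ‖hS.res τ x‖ := by gcongr
        _ = |τ| * (|τ| * ‖hS.res τ x‖) := by ring
        _ ≤ |τ| * ‖x‖ := by gcongr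
    · rw [div_lt_one hm, hμτ]; linarith
  obtain ⟨U, hU⟩ := isUnit_one_sub_of_norm_lt_one hBn
  obtain ⟨x, hx⟩ : ∃ x, x + B x = hT.res m z := by
    refine ⟨(↑U⁻¹ : E →L[ℂ] E) (hT.res m z), ?_⟩
    have h1 : (U : E →L[ℂ] E) ((↑U⁻¹ : E →L[ℂ] E) (hT.res m z)) = hT.res m z := by
      rw [← mul_apply_eq_comp, Units.mul_inv, one_apply_eq_self]
    conv_rhs => rw [← h1, hU]
    simp
  have hxr : hT.res m (z - (τ ^ 2 : ℂ) • hS.res τ x) = x := by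
    rw [map_sub, map_smul, ← hx, hB]; simp
  have hxT := hT.res_mem hm0 (z - (τ ^ 2 : ℂ) • hS.res τ x)
  rw [hxr] at hxT
  obtain ⟨-, y, s, t, p, q, h, hy⟩ := hR τ hl hxT
  replace hy : s + ((τ : ℂ) * I) • y = x := hy
  have hyr : hS.res τ x = y := by rw [← hy, hS.res_eq hτ0 h.left]
  rw [hyr] at hxT hxr
  refine ⟨x, _, y, s, t, p, q, hxT, h, hy, ?_, ?_⟩
  · rw [eq_sub_of_add_eq hy, hmdef]
    push_cast
    match_scalars
    · ring
    · linear_combination (-(τ : ℂ) ^ 2) * I_sq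
    · ring
  · have h1 := hT.abs_mul_norm_res_le hm0 (z - (τ ^ 2 : ℂ) • y)
    rw [hxr, hμτ] at h1
    have h2 := hS.abs_mul_norm_res_le hτ0 x
    rw [hyr] at h2
    have h3 : ‖(τ ^ 2 : ℂ) • y‖ ≤ |τ| * ‖x‖ := by
      rw [norm_smul, norm_pow, norm_real, Real.norm_eq_abs, pow_two, mul_assoc]
      gcongr
    linarith [norm_sub_le z ((τ ^ 2 : ℂ) • y)]

/-- The cross term between `Tx` and the Yosida approximation of `S` is exactly an anticommutator
term at `y = (S + iτ)⁻¹x`. -/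
theorem inner_yosida (hS : IsSymmSurj A S) (hT : IsSymmSurj A T) {τ : ℝ}
    {x x' y s t p q : E} (hx : (x, x') ∈ T.graph) (h : AntiData S T y s t p q)
    (hy : s + ((τ : ℂ) * I) • y = x) :
    inner A (x' + ((τ : ℂ) * I) • s) (x' + ((τ : ℂ) * I) • s) =
      inner A x' x' + (τ ^ 2 : ℂ) • inner A s s + (τ ^ 2 : ℂ) • inner A y (p + q) := by
  have hs : star ((τ : ℂ) * I) = -((τ : ℂ) * I) := by simp
  have h1 : inner A x' y = inner A x t := hT.symm hx h.right
  have h2 : inner A s t = inner A y p := hS.symm h.left h.left_right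
  have h3 : inner A x' x = inner A x x' := hT.symm hx hx
  have h4 : x' = q + ((τ : ℂ) * I) • t := h.shift_eq hy hx
  have h5 : inner A y x' = inner A y (p + q) - inner A x t := by
    rw [← hy, h4]
    simp only [CStarModule.inner_add_left, CStarModule.inner_add_right,
      CStarModule.inner_smul_left_complex, CStarModule.inner_smul_right_complex, hs, h2]
    module
  have h6 : ((τ : ℂ) * I) • s = ((τ : ℂ) * I) • x + (τ ^ 2 : ℂ) • y := by
    rw [← hy]
    match_scalars
    · ring
    · linear_combination (-(τ : ℂ) ^ 2) * I_sq
  have h7 : inner A (((τ : ℂ) * I) • s) (((τ : ℂ) * I) • s) = (τ ^ 2 : ℂ) • inner A s s := by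
    simp only [CStarModule.inner_smul_left_complex, CStarModule.inner_smul_right_complex, hs]
    match_scalars
    linear_combination (-(τ : ℂ) ^ 2) * I_sq
  have hs2 : star ((τ : ℂ) ^ 2) = (τ : ℂ) ^ 2 := by simp
  rw [CStarModule.inner_add_left, CStarModule.inner_add_right, CStarModule.inner_add_right, h7,
    h6]
  simp only [CStarModule.inner_add_left, CStarModule.inner_add_right,
    CStarModule.inner_smul_left_complex, CStarModule.inner_smul_right_complex, hs, hs2, h1, h3,
    h5]
  module

/-- In `inner_yosida` the error is at most `(|τ|‖y‖)(|τ|‖p + q‖)`, with first factor at most `‖x‖`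
and second factor affine in `‖x'‖` and `|τ|‖s‖`. So the maximum `m` of these two satisfies `m² ≤ c +
d m`, whence `m ≤ 1 + c + d`, uniformly in `τ`. -/
theorem yosida_bound (hS : IsSymmSurj A S) (hT : IsSymmSurj A T) {C τ F X : ℝ}
    (hE : FormEstimate A S T C) (hτ : 2 * √C ≤ |τ|) (hτ1 : 1 ≤ |τ|)
    {x x' y s t p q : E} (hx : (x, x') ∈ T.graph) (h : AntiData S T y s t p q)
    (hy : s + ((τ : ℂ) * I) • y = x) (hF : ‖x' + ((τ : ℂ) * I) • s‖ ≤ F) (hX : ‖x‖ ≤ X) :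
    max ‖x'‖ (|τ| * ‖s‖) ≤ 1 + (F ^ 2 + X * (√C * (X + 4 * √C * X))) + 3 * X * √C := by
  have hM : 0 ≤ √C := Real.sqrt_nonneg C
  have hX0 : 0 ≤ X := (norm_nonneg _).trans hX
  have hid := inner_yosida hS hT hx h hy
  have hcast : (τ ^ 2 : ℂ) • inner A s s = inner A ((|τ|) • s) ((|τ|) • s) := by
    simp only [CStarModule.inner_smul_left_real, CStarModule.inner_smul_right_real, smul_smul,
      ← pow_two, sq_abs]
    rw [← Complex.ofReal_pow]; rfl
  rw [hcast] at hid
  set f := x' + ((τ : ℂ) * I) • s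
  have hyx : |τ| * ‖y‖ ≤ ‖x‖ := by
    have := hS.abs_mul_norm_le h.left τ
    rwa [hy] at this
  have hh : |τ| * ‖p + q‖ ≤ √C * (X + |τ| * ‖s‖ + (4 * √C * X + 2 * ‖x'‖)) := by
    have h1 := hE.norm_le h
    have h2 := h.abs_mul_norm_le hS hy hx
    have h3 := h.norm_anticommutator_le hS hE hτ hτ1 hy hx
    calc |τ| * ‖p + q‖ ≤ |τ| * (√C * (‖y‖ + ‖s‖ + ‖t‖)) := by gcongr
      _ = √C * (|τ| * ‖y‖ + |τ| * ‖s‖ + |τ| * ‖t‖) := by ring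
      _ ≤ √C * (X + |τ| * ‖s‖ + (4 * √C * X + 2 * ‖x'‖)) := by
        have : 4 * √C * ‖x‖ ≤ 4 * √C * X := by gcongr
        gcongr ?_ * (?_ + _ + ?_)
        · linarith
        · linarith
  have hr : ‖(τ ^ 2 : ℂ) • inner A y (p + q)‖ ≤
      X * (√C * (X + |τ| * ‖s‖ + (4 * √C * X + 2 * ‖x'‖))) := by
    rw [norm_smul, norm_pow, norm_real, Real.norm_eq_abs]
    calc |τ| ^ 2 * ‖inner A y (p + q)‖ ≤ |τ| ^ 2 * (‖y‖ * ‖p + q‖) := by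
          gcongr; exact CStarModule.norm_inner_le E
      _ = (|τ| * ‖y‖) * (|τ| * ‖p + q‖) := by ring
      _ ≤ X * (√C * (X + |τ| * ‖s‖ + (4 * √C * X + 2 * ‖x'‖))) := by
          gcongr
          exact hyx.trans hX
  have hff : ‖inner A f f - (τ ^ 2 : ℂ) • inner A y (p + q)‖ ≤
      F ^ 2 + X * (√C * (X + |τ| * ‖s‖ + (4 * √C * X + 2 * ‖x'‖))) := by
    refine (norm_sub_le _ _).trans (add_le_add ?_ hr)
    rw [norm_inner_self]; gcongr
  have ha : ‖x'‖ ^ 2 ≤ F ^ 2 + X * (√C * (X + |τ| * ‖s‖ + (4 * √C * X + 2 * ‖x'‖))) := by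
    refine (norm_sq_le_of_inner_le A ?_).trans hff
    rw [hid, add_sub_cancel_right]
    exact le_add_of_nonneg_right CStarModule.inner_self_nonneg
  have hb : (|τ| * ‖s‖) ^ 2 ≤
      F ^ 2 + X * (√C * (X + |τ| * ‖s‖ + (4 * √C * X + 2 * ‖x'‖))) := by
    have : |τ| * ‖s‖ = ‖|τ| • s‖ := by rw [norm_smul, Real.norm_eq_abs, abs_abs]
    rw [this] at hff ⊢
    refine (norm_sq_le_of_inner_le A ?_).trans hff
    rw [hid, add_sub_cancel_right]
    exact le_add_of_nonneg_left CStarModule.inner_self_nonneg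
  set a := ‖x'‖
  set b := |τ| * ‖s‖
  set m := max a b with hm
  have ham : a ≤ m := le_max_left _ _
  have hbm : b ≤ m := le_max_right _ _
  have hXM : 0 ≤ X * √C := mul_nonneg hX0 hM
  have hrhs : F ^ 2 + X * (√C * (X + b + (4 * √C * X + 2 * a))) ≤
      (F ^ 2 + X * (√C * (X + 4 * √C * X))) + 3 * X * √C * m := by
    nlinarith [mul_le_mul_of_nonneg_left ham hXM, mul_le_mul_of_nonneg_left hbm hXM]
  have hm2 : m ^ 2 ≤ (F ^ 2 + X * (√C * (X + 4 * √C * X))) + 3 * X * √C * m := by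
    rcases max_choice a b with h' | h'
    · rw [hm] at hrhs ⊢; rw [h'] at hrhs ⊢; exact ha.trans hrhs
    · rw [hm] at hrhs ⊢; rw [h'] at hrhs ⊢; exact hb.trans hrhs
  have hc0 : 0 ≤ F ^ 2 + X * (√C * (X + 4 * √C * X)) := by positivity
  have hd0 : 0 ≤ 3 * X * √C := by positivity
  generalize F ^ 2 + X * (√C * (X + 4 * √C * X)) = c at hm2 hc0
  generalize 3 * X * √C = d at hm2 hd0
  by_contra! hlt
  nlinarith

/-- The range of `S + T + i μ` as a submodule. -/
def shiftRange (S : E →ₗ.[ℂ] E) (μ : ℝ) : Submodule ℂ E :=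
  S.graph.map (LinearMap.snd ℂ E E + ((μ : ℂ) * I) • LinearMap.fst ℂ E E)

theorem mem_shiftRange {μ : ℝ} {z : E} :
    z ∈ shiftRange S μ ↔ ∃ x x', (x, x') ∈ S.graph ∧ x' + ((μ : ℂ) * I) • x = z := by
  simp only [shiftRange, Submodule.mem_map, Prod.exists]
  rfl

theorem dense_shiftRange_add (hS : IsSymmSurj A S) (hT : IsSymmSurj A T) {C l μ : ℝ}
    (hE : FormEstimate A S T C) (hR : ResolventMapsDomain S T l) (hμ : μ ≠ 0) (z : E) :
    z ∈ closure (shiftRange (S + T) μ : Set E) := by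
  have hμ' : 0 < |μ| := abs_pos.2 hμ
  have hM : 0 ≤ √C := Real.sqrt_nonneg C
  set ρ : ℕ → ℝ := fun n => n + (|l| + 2 * √C + 1) with hρ
  -- The parameter takes the sign of `μ`, as the Neumann series requires.
  set τ : ℕ → ℝ := fun n => μ / |μ| * ρ n with hτdef
  have hσ : |(μ / |μ|)| = 1 := by rw [abs_div, abs_abs, div_self hμ'.ne']
  have hn0 : ∀ n : ℕ, (0 : ℝ) ≤ n := fun n => n.cast_nonneg
  have hpos : ∀ n, 0 < ρ n := fun n => by positivity
  have habs : ∀ n, |τ n| = ρ n := fun n => by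
    rw [hτdef]; simp only [abs_mul, hσ, one_mul, abs_of_pos (hpos n)]
  have hl : ∀ n, l ≤ |τ n| := fun n => by
    rw [habs]; simp only [hρ]; linarith [le_abs_self l, hn0 n]
  have hτ0 : ∀ n, 2 * √C ≤ |τ n| := fun n => by
    rw [habs]; simp only [hρ]; linarith [abs_nonneg l, hn0 n]
  have hτ1 : ∀ n, 1 ≤ |τ n| := fun n => by
    rw [habs]; simp only [hρ]; linarith [abs_nonneg l, hn0 n]
  have hτ : Tendsto (fun n => |τ n|) atTop atTop := by
    simp only [habs]
    exact tendsto_atTop_add_const_right _ _ tendsto_natCast_atTop_atTop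
  have hne : ∀ n, τ n ≠ 0 := fun n => abs_pos.1 (zero_lt_one.trans_le (hτ1 n))
  have hμτ : ∀ n, |μ + τ n| = |μ| + |τ n| := fun n => by
    have : μ + τ n = μ / |μ| * (|μ| + ρ n) := by simp only [hτdef]; field_simp
    rw [this, abs_mul, hσ, one_mul, habs, abs_of_pos (add_pos hμ' (hpos n))]
  choose x x' y s t p q hx h hy hz hxz using fun n =>
    exists_yosida_solution hS hT hR hμ (hne n) (hl n) (hμτ n) z
  set X := ‖z‖ / |μ| with hX
  have hxX : ∀ n, ‖x n‖ ≤ X := fun n => by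
    rw [hX, le_div_iff₀ hμ', mul_comm]; exact hxz n
  have hF : ∀ n, ‖x' n + ((τ n : ℂ) * I) • s n‖ ≤ 2 * ‖z‖ := fun n => by
    rw [eq_sub_of_add_eq (hz n)]
    refine (norm_sub_le _ _).trans ?_
    have : ‖((μ : ℂ) * I) • x n‖ = |μ| * ‖x n‖ := by
      rw [norm_smul, norm_mul, norm_I, mul_one, norm_real, Real.norm_eq_abs]
    rw [this]; linarith [hxz n]
  have hD := fun n => yosida_bound hS hT hE (hτ0 n) (hτ1 n) (hx n) (h n) (hy n) (hF n) (hxX n)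
  set D := 1 + ((2 * ‖z‖) ^ 2 + X * (√C * (X + 4 * √C * X))) + 3 * X * √C
  have hs : Tendsto s atTop (𝓝 0) := by
    refine squeeze_zero_norm (a := fun n => |τ n|⁻¹ * D) (fun n => ?_)
      (by simpa using (tendsto_inv_atTop_zero.comp hτ).mul_const D)
    rw [le_inv_mul_iff₀ (abs_pos.2 (hne n))]
    exact (le_max_right _ _).trans (hD n)
  have hnτ : ∀ n (e : E), ‖((τ n : ℂ) * I) • e‖ = |τ n| * ‖e‖ := fun n e => by
    rw [norm_smul, norm_mul, norm_I, mul_one, norm_real, Real.norm_eq_abs]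
  -- The approximate solution need not lie in `D(S)`; its regularization `iτy` lies in both domains,
  -- and `ζ n` is its image under `S + T + iμ`.
  set ζ : ℕ → E := fun n => ((τ n : ℂ) * I) • s n + ((τ n : ℂ) * I) • t n +
    ((μ : ℂ) * I) • (((τ n : ℂ) * I) • y n) with hζ
  have hζmem : ∀ n, ζ n ∈ shiftRange (S + T) μ := fun n =>
    mem_shiftRange.2 ⟨((τ n : ℂ) * I) • y n, ((τ n : ℂ) * I) • s n + ((τ n : ℂ) * I) • t n,
      mem_graph_add_iff.2 ⟨_, _, S.graph.smul_mem _ (h n).left, T.graph.smul_mem _ (h n).right,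
        rfl⟩, rfl⟩
  have hζM : ∀ n, ‖ζ n‖ ≤ D + (4 * √C * X + D + D) + |μ| * X := fun n => by
    have a1 : |τ n| * ‖s n‖ ≤ D := (le_max_right _ _).trans (hD n)
    have a2 : ‖x' n‖ ≤ D := (le_max_left _ _).trans (hD n)
    have a3 := (h n).abs_mul_norm_le hS (hy n) (hx n)
    have a4 := (h n).norm_anticommutator_le hS hE (hτ0 n) (hτ1 n) (hy n) (hx n)
    have a5 : 4 * √C * ‖x n‖ ≤ 4 * √C * X := by gcongr; exact hxX n
    have a6 := hS.abs_mul_norm_le (h n).left (τ n)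
    rw [hy] at a6
    refine norm_add₃_le.trans ?_
    rw [hnτ, hnτ]
    have a7 : ‖((μ : ℂ) * I) • (((τ n : ℂ) * I) • y n)‖ ≤ |μ| * X := by
      rw [norm_smul, hnτ, norm_mul, norm_I, mul_one, norm_real, Real.norm_eq_abs]
      gcongr
      exact a6.trans (hxX n)
    linarith
  have hw : ∀ u ∈ ((S + T).domain : Set E),
      Tendsto (fun n => inner A u (ζ n - z)) atTop (𝓝 0) := by
    intro u hu
    obtain ⟨w, hw⟩ := LinearPMap.mem_domain_iff.1 hu.2
    -- Moving `T` onto `u` leaves only terms in `s n`, which tends to zero in norm.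
    have e : ∀ n, inner A u (ζ n - z) =
        -(inner A w (s n)) - ((μ : ℂ) * I) • inner A u (s n) := fun n => by
      have e1 : ζ n - z = (((τ n : ℂ) * I) • t n - x' n) - ((μ : ℂ) * I) • s n := by
        rw [hζ, ← hz n, ← hy n]; module
      have e2 : s n = x n - ((τ n : ℂ) * I) • y n := eq_sub_of_add_eq (hy n)
      have e3 : inner A w (s n) = inner A u (x' n) - ((τ n : ℂ) * I) • inner A u (t n) := by
        rw [e2, CStarModule.inner_sub_right, CStarModule.inner_smul_right_complex,
          hT.symm hw (hx n), hT.symm hw (h n).right]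
      rw [e1, e3]
      simp only [CStarModule.inner_sub_right, CStarModule.inner_smul_right_complex]
      abel
    simp only [e]
    have l1 := tendsto_inner A (tendsto_const_nhds (x := w)) hs
    have l2 := (tendsto_inner A (tendsto_const_nhds (x := u)) hs).const_smul ((μ : ℂ) * I)
    simpa using l1.neg.sub l2
  have hmem := mem_closure_of_weak_limit A
    ((⊤ : Submodule ℂ E).prod (shiftRange (S + T) μ)) (u := fun _ => (0 : E)) (x := 0)
    (fun n => ⟨trivial, hζmem n⟩) tendsto_const_nhds hζM
    (tendsto_inner_of_dense A (dense_domain_add hS hT.dense hR) hζM hw)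
  rw [Submodule.prod_coe, closure_prod_eq] at hmem
  exact hmem.2

/-- The sum of a weakly anticommuting pair is self-adjoint and regular. -/
theorem IsSymmSurj.add (hS : IsSymmSurj A S) (hT : IsSymmSurj A T) {C l : ℝ}
    (hE : FormEstimate A S T C) (hR : ResolventMapsDomain S T l) : IsSymmSurj A (S + T) where
  symm hx hy := symm_graph_add hS hT hx hy
  dense := dense_domain_add hS hT.dense hR
  surj μ hμ z := by
    have hμ' : 0 < |μ| := abs_pos.2 hμ
    rw [← mem_shiftRange]
    -- Dense range is known. Closed range: `x` and `(S + T)x` are controlled by `(S + T + iμ)x`, and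
    -- coercivity controls `Sx` and hence `Tx`.
    suffices hc : IsClosed (shiftRange (S + T) μ : Set E) by
      have := dense_shiftRange_add hS hT hE hR hμ z
      rwa [hc.closure_eq] at this
    refine IsSeqClosed.isClosed fun w w₀ hw hlim => ?_
    choose x x' hx hxw using fun n => mem_shiftRange.1 (hw n)
    choose s t hs ht hst using fun n => mem_graph_add_iff.1 (hx n)
    have hsym : ∀ m n, inner A (x' m - x' n) (x m - x n) = inner A (x m - x n) (x' m - x' n) :=
      fun m n => symm_graph_add hS hT ((S + T).graph.sub_mem (hx m) (hx n))
        ((S + T).graph.sub_mem (hx m) (hx n))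
    have hwsub : ∀ m n, x' m - x' n + ((μ : ℂ) * I) • (x m - x n) = w m - w n := fun m n => by
      rw [← hxw, ← hxw]; module
    have b1 : ∀ m n, ‖x m - x n‖ ≤ |μ|⁻¹ * ‖w m - w n‖ := fun m n => by
      rw [le_inv_mul_iff₀ hμ', ← hwsub]
      exact HilbertModuleOp.abs_mul_norm_le A (hsym m n) μ
    have b2 : ∀ m n, ‖x' m - x' n‖ ≤ 1 * ‖w m - w n‖ := fun m n => by
      rw [one_mul, ← hwsub]
      exact norm_le_norm_add_I_smul A (hsym m n) μ
    have hC : 0 ≤ 1 + C := by linarith [hE.pos]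
    have b3 : ∀ m n, ‖s m - s n‖ ≤ √(2 + (1 + C) * |μ|⁻¹ ^ 2) * ‖w m - w n‖ := fun m n => by
      have h1 := norm_sq_le_of_coercive hS hT hE hR (x := x m - x n) (s := s m - s n)
        (t := t m - t n) (S.graph.sub_mem (hs m) (hs n)) (T.graph.sub_mem (ht m) (ht n))
      have h2 : (s m - s n) + (t m - t n) = x' m - x' n := by rw [← hst, ← hst]; abel
      refine le_of_sq_le_sq ?_ (by positivity)
      rw [mul_pow, Real.sq_sqrt (by positivity)]
      refine h1.trans ?_
      rw [h2]
      calc 2 * ‖x' m - x' n‖ ^ 2 + (1 + C) * ‖x m - x n‖ ^ 2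
          ≤ 2 * (1 * ‖w m - w n‖) ^ 2 + (1 + C) * (|μ|⁻¹ * ‖w m - w n‖) ^ 2 := by
            gcongr
            · exact b2 m n
            · exact b1 m n
        _ = (2 + (1 + C) * |μ|⁻¹ ^ 2) * ‖w m - w n‖ ^ 2 := by ring
    obtain ⟨x₀, hx₀⟩ := cauchySeq_tendsto_of_complete (cauchySeq_of_norm_sub_le hlim.cauchySeq _ b1)
    obtain ⟨y₀, hy₀⟩ := cauchySeq_tendsto_of_complete (cauchySeq_of_norm_sub_le hlim.cauchySeq _ b2)
    obtain ⟨s₀, hs₀⟩ := cauchySeq_tendsto_of_complete (cauchySeq_of_norm_sub_le hlim.cauchySeq _ b3)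
    have ht₀ : Tendsto t atTop (𝓝 (y₀ - s₀)) :=
      (hy₀.sub hs₀).congr fun n => by rw [← hst n]; abel
    refine mem_shiftRange.2 ⟨x₀, y₀, mem_graph_add_iff.2 ⟨s₀, y₀ - s₀,
      hS.mem_graph_of_tendsto hs hx₀ hs₀, hT.mem_graph_of_tendsto ht hx₀ ht₀, by abel⟩, ?_⟩
    refine tendsto_nhds_unique (hy₀.add (hx₀.const_smul ((μ : ℂ) * I))) ?_
    simpa only [hxw] using hlim

end Sum

/-! ### Symmetry of weak anticommutation and additivity. -/

section Swap

variable {A : Type*} {E : Type*} [NonUnitalCStarAlgebra A] [PartialOrder A] [StarOrderedRing A]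
  [NormedAddCommGroup E] [NormedSpace ℂ E] [SMul A E] [CStarModule A E]
  {S T : E →ₗ.[ℂ] E}

theorem FormEstimate.mono {C C' : ℝ} (hE : FormEstimate A S T C) (h : C ≤ C') :
    FormEstimate A S T C' where
  pos := hE.pos.trans_le h
  le hd := (hE.le hd).trans (smul_le_smul_of_nonneg_right h
    (add_nonneg (add_nonneg CStarModule.inner_self_nonneg CStarModule.inner_self_nonneg)
      CStarModule.inner_self_nonneg))

/-- Scaling `S` by `|c| ≤ 1` keeps the same `C`, so the bounds for `±εS` are uniform in `ε`. -/
theorem FormEstimate.smul_left {C c : ℝ} (hE : FormEstimate A S T C) (hc : c ≠ 0)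
    (hc1 : c ^ 2 ≤ 1) : FormEstimate A ((c : ℂ) • S) T C where
  pos := hE.pos
  le {x s t p q} hd := by
    have hc' : (c : ℂ) ≠ 0 := by exact_mod_cast hc
    obtain ⟨r, hr, rfl⟩ := exists_of_mem_graph_smul hd.left
    obtain ⟨p', hp', rfl⟩ := exists_of_mem_graph_smul hd.left_right
    have hq := T.graph.smul_mem (c : ℂ)⁻¹ hd.right_left
    rw [Prod.smul_mk, inv_smul_smul₀ hc'] at hq
    have hd' : AntiData S T x r t p' ((c : ℂ)⁻¹ • q) := ⟨hr, hd.right, hp', hq⟩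
    have h1 := smul_le_smul_of_nonneg_left (hE.le hd') (sq_nonneg c)
    have e : (c : ℂ) • p' + q = c • (p' + (c : ℂ)⁻¹ • q) := by
      rw [← Complex.coe_smul, smul_add, smul_inv_smul₀ hc']
    have e2 : (c : ℂ) • r = c • r := Complex.coe_smul c r
    rw [e, e2]
    simp only [CStarModule.inner_smul_left_real, CStarModule.inner_smul_right_real]
    rw [smul_smul, ← pow_two]
    refine h1.trans ?_
    rw [smul_comm]
    refine smul_le_smul_of_nonneg_left ?_ hE.pos.le
    rw [smul_smul, ← pow_two, smul_add, smul_add]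
    have h2 : ∀ y : E, (c ^ 2) • inner A y y ≤ inner A y y := fun y => by
      conv_rhs => rw [← one_smul ℝ (inner A y y)]
      exact smul_le_smul_of_nonneg_right hc1 CStarModule.inner_self_nonneg
    exact add_le_add (add_le_add (h2 x) le_rfl) (h2 t)

theorem ResolventMapsDomain.smul_left {l c : ℝ} (hR : ResolventMapsDomain S T l) (hc : c ≠ 0)
    (hc1 : |c| ≤ 1) : ResolventMapsDomain ((c : ℂ) • S) T l := by
  rintro τ hτ ⟨x, x'⟩ hx
  have hc' : (c : ℂ) ≠ 0 := by exact_mod_cast hc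
  have hl : l ≤ |τ / c| := by
    rw [abs_div]
    exact hτ.trans (le_div_self (abs_nonneg _) (abs_pos.2 hc) hc1)
  obtain ⟨-, y, s, t, p, q, h, hy⟩ := hR (τ / c) hl (T.graph.smul_mem (c : ℂ)⁻¹ hx)
  refine ⟨hx, y, (c : ℂ) • s, t, (c : ℂ) • p, (c : ℂ) • q, ⟨mem_graph_smul h.left, h.right,
    mem_graph_smul h.left_right, T.graph.smul_mem (c : ℂ) h.right_left⟩, ?_⟩
  have h1 := congrArg (fun z => (c : ℂ) • z) hy
  simp only [Prod.smul_fst, smul_inv_smul₀ hc', smul_add, smul_smul] at h1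
  rw [← h1]
  congr 2
  push_cast
  field_simp

variable [CompleteSpace E]

/-- One step of the regularization `(T + ε S + i ν) y = x` used to exchange the roles of `S`
and `T`. -/
theorem exists_perturbed_solution (hS : IsSymmSurj A S) (hT : IsSymmSurj A T) {C l ν ε : ℝ}
    (hE : FormEstimate A S T C) (hR : ResolventMapsDomain S T l) (hν : 4 * √C + 1 ≤ |ν|)
    (hε : 0 < ε) (hε1 : ε ≤ 1) {x x' : E} (hx : (x, x') ∈ S.graph) :
    ∃ s r, (s, r) ∈ S.graph ∧
      (x - (ε : ℂ) • s, x' - (ε : ℂ) • r) ∈ resolventGraph T S ν ∧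
      ‖s‖ ≤ 2 * √C * ‖x‖ + ‖x'‖ ∧
      ‖(ε : ℂ) • r‖ ^ 2 ≤
        2 * (√C * (2 * ‖x‖ + 2 * (2 * √C * ‖x‖ + ‖x'‖)) + ‖x'‖) ^ 2 +
          (1 + C) * (2 * √C * ‖x‖ + ‖x'‖) ^ 2 := by
  have hM : 0 ≤ √C := Real.sqrt_nonneg C
  have hν0 : ν ≠ 0 := abs_pos.1 (by linarith)
  have hεsq : ε ^ 2 ≤ 1 := pow_le_one₀ hε.le hε1
  have hεabs : |ε| ≤ 1 := by rwa [abs_of_pos hε]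
  have hSp := hS.smul hε.ne'
  have hEp := hE.smul_left hε.ne' hεsq
  have hRp := hR.smul_left hε.ne' hεabs
  have hSm := hS.smul (neg_ne_zero.2 hε.ne')
  have hEm := hE.smul_left (neg_ne_zero.2 hε.ne') (by rwa [neg_sq])
  have hRm := hR.smul_left (neg_ne_zero.2 hε.ne') (by rwa [abs_neg])
  have hGp := hSp.add hT hEp hRp
  have hGm := hSm.add hT hEm hRm
  obtain ⟨y, g, hg, hgx⟩ := hGp.surj ν hν0 x
  obtain ⟨s', t, hs', ht, rfl⟩ := mem_graph_add_iff.1 hg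
  obtain ⟨s, hs, rfl⟩ := exists_of_mem_graph_smul hs'
  obtain ⟨h, hle, hh⟩ := exists_extended_anticommutator hS hT hE hR hs ht
  -- Formally, apply `S` to `(T + εS + iν)y = x` and replace `STy` by `h - TSy`: this gives `(T -
  -- εS)s = h - x' + iνs` for `s = Sy`. It is proved weakly, using that `T - εS` contains its
  -- adjoint; this puts `Sy` in `D(S) ∩ D(T)`.
  have hmem : (s, h - x' + ((ν : ℂ) * I) • s) ∈ ((((-ε : ℝ) : ℂ) • S) + T).graph := by
    refine hGm.mem_graph_of_adjoint fun u v huv => ?_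
    obtain ⟨v₁, w, hv₁, hw, rfl⟩ := mem_graph_add_iff.1 huv
    obtain ⟨v, hv, rfl⟩ := exists_of_mem_graph_smul hv₁
    have h1 : inner A u h = inner A v t + inner A w s := by
      rw [← CStarModule.star_inner h u, hh u v w hv hw, star_add, CStarModule.star_inner,
        CStarModule.star_inner]
    have h2 : inner A v y = inner A u s := hS.symm hv hs
    have h3 : inner A v x = inner A u x' := hS.symm hv hx
    have hstar : star (((-ε : ℝ) : ℂ)) = -(ε : ℂ) := by simp
    rw [← hgx] at h3
    simp only [CStarModule.inner_add_left, CStarModule.inner_add_right,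
      CStarModule.inner_sub_right, CStarModule.inner_smul_left_complex,
      CStarModule.inner_smul_right_complex, hstar, h1, h2, ← h3]
    module
  obtain ⟨r', t', hr', ht', hrt⟩ := mem_graph_add_iff.1 hmem
  obtain ⟨r, hr, rfl⟩ := exists_of_mem_graph_smul hr'
  have hshift : h - x' + ((ν : ℂ) * I) • s + (((-ν : ℝ) : ℂ) * I) • s = h - x' := by
    push_cast; module
  have c1 := hGm.abs_mul_norm_le hmem (-ν)
  have c2 := hGm.norm_le hmem (-ν)
  rw [hshift] at c1 c2
  rw [abs_neg] at c1
  have c3 := norm_le_of_inner_le hE.pos.le hle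
  have c4 := hGp.abs_mul_norm_le hg ν
  have c5 := hGp.norm_le hg ν
  rw [hgx] at c4 c5
  have hn : ‖(ε : ℂ) • s‖ ≤ ‖s‖ := by
    rw [norm_smul, norm_real, Real.norm_eq_abs]
    exact mul_le_of_le_one_left (norm_nonneg _) hεabs
  have c6 : ‖t‖ ≤ ‖x‖ + ‖s‖ := by
    have : t = ((ε : ℂ) • s + t) - (ε : ℂ) • s := by abel
    rw [this]
    exact (norm_sub_le _ _).trans (add_le_add c5 hn)
  have c7 : ‖y‖ ≤ ‖x‖ := by nlinarith [norm_nonneg y]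
  have c8 : ‖h‖ ≤ √C * (2 * ‖x‖ + 2 * ‖s‖) := 
    c3.trans (mul_le_mul_of_nonneg_left (by linarith) hM)
  have c9 : ‖h - x'‖ ≤ ‖h‖ + ‖x'‖ := norm_sub_le _ _
  have c10 : ‖s‖ ≤ 2 * √C * ‖x‖ + ‖x'‖ := by
    -- The bound on `h` contributes `2√C‖s‖`, which the threshold on `|ν|` absorbs.
    have d1 : (4 * √C + 1) * ‖s‖ ≤ |ν| * ‖s‖ := by gcongr
    have d2 : 0 ≤ √C * ‖s‖ := by positivity
    nlinarith
  have c11 : ‖h - x'‖ ≤ √C * (2 * ‖x‖ + 2 * (2 * √C * ‖x‖ + ‖x'‖)) + ‖x'‖ := by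
    refine c9.trans ?_
    gcongr
    exact c8.trans (by gcongr)
  have c12 := norm_sq_le_of_coercive hSm hT hEm hRm hr' ht'
  rw [hrt] at c12
  refine ⟨s, r, hr, ⟨S.graph.sub_mem hx (S.graph.smul_mem _ hr), y, t, s, t',
    (x' - (ε : ℂ) • r) - ((ν : ℂ) * I) • s, ⟨ht, hs, ht', ?_⟩, ?_⟩, c10, ?_⟩
  · have : t = (x - (ε : ℂ) • s) - ((ν : ℂ) * I) • y := by rw [← hgx]; abel
    rw [this]
    exact S.graph.sub_mem (S.graph.sub_mem hx (S.graph.smul_mem _ hr)) (S.graph.smul_mem _ hs)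
  · change t + ((ν : ℂ) * I) • y = x - (ε : ℂ) • s
    rw [← hgx]; abel
  · have e : ‖((-ε : ℝ) : ℂ) • r‖ = ‖(ε : ℂ) • r‖ := by
      rw [norm_smul, norm_smul]; simp
    rw [e] at c12
    refine c12.trans ?_
    have : 0 ≤ 1 + C := by linarith [hE.pos]
    gcongr
    exact c2.trans c11

/-- Weak anticommutativity is symmetric in the two operators. -/
theorem ResolventMapsDomain.swap (hS : IsSymmSurj A S) (hT : IsSymmSurj A T) {C l : ℝ}
    (hE : FormEstimate A S T C) (hR : ResolventMapsDomain S T l) :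
    ResolventMapsDomain T S (4 * √C + 1) := by
  rintro ν hν ⟨x, x'⟩ hx
  have hM : 0 ≤ √C := Real.sqrt_nonneg C
  set ε : ℕ → ℝ := fun n => 1 / ((n : ℝ) + 1) with hε
  have hε0 : ∀ n, 0 < ε n := fun n => by positivity
  have hε1 : ∀ n, ε n ≤ 1 := fun n => by
    simp only [hε]
    rw [div_le_one (by positivity)]
    linarith [n.cast_nonneg (α := ℝ)]
  have hlim : Tendsto ε atTop (𝓝 0) := tendsto_one_div_add_atTop_nhds_zero_nat
  choose s r hsr hmem hsB hrB using fun n =>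
    exists_perturbed_solution hS hT hE hR hν (hε0 n) (hε1 n) hx
  set B := 2 * √C * ‖x‖ + ‖x'‖
  set D := 2 * (√C * (2 * ‖x‖ + 2 * B) + ‖x'‖) ^ 2 + (1 + C) * B ^ 2
  -- As `ε → 0` the pairs `(x - εs, x' - εr)` converge strongly in the first entry but only weakly
  -- in the second, `εr` being merely bounded. The Banach–Saks lemma and this closedness still place
  -- `(x, x')` in the resolvent graph.
  have hclosed := isClosed_resolventGraph hT hS hE.symm (τ := ν) (by linarith) (by linarith)
  have hcn : ∀ n (z : E), ‖(ε n : ℂ) • z‖ = ε n * ‖z‖ := fun n z => by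
    rw [norm_smul, norm_real, Real.norm_of_nonneg (hε0 n).le]
  have hu : Tendsto (fun n => x - (ε n : ℂ) • s n) atTop (𝓝 x) := by
    have : Tendsto (fun n => (ε n : ℂ) • s n) atTop (𝓝 0) := by
      refine squeeze_zero_norm (a := fun n => ε n * B) (fun n => ?_)
        (by simpa using hlim.mul_const B)
      rw [hcn]
      exact mul_le_mul_of_nonneg_left (hsB n) (hε0 n).le
    simpa using (tendsto_const_nhds (x := x)).sub this
  have hvM : ∀ n, ‖x' - (ε n : ℂ) • r n‖ ≤ ‖x'‖ + √D := fun n =>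
    (norm_sub_le _ _).trans (add_le_add le_rfl (Real.le_sqrt_of_sq_le (hrB n)))
  have hw : ∀ u ∈ (S.domain : Set E),
      Tendsto (fun n => inner A u (x' - (ε n : ℂ) • r n - x')) atTop (𝓝 0) := by
    intro u hu
    obtain ⟨v, hv⟩ := LinearPMap.mem_domain_iff.1 hu
    refine squeeze_zero_norm (a := fun n => ε n * (‖v‖ * B)) (fun n => ?_)
      (by simpa using hlim.mul_const (‖v‖ * B))
    have e : inner A u (x' - (ε n : ℂ) • r n - x') = -((ε n : ℂ) • inner A v (s n)) := by
      rw [hS.symm hv (hsr n)]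
      simp
    rw [e, norm_neg, norm_smul, norm_real, Real.norm_of_nonneg (hε0 n).le]
    refine mul_le_mul_of_nonneg_left ((CStarModule.norm_inner_le E).trans ?_) (hε0 n).le
    exact mul_le_mul_of_nonneg_left (hsB n) (norm_nonneg _)
  have := mem_closure_of_weak_limit A (resolventGraph T S ν) hmem hu hvM
    (tendsto_inner_of_dense A hS.dense hvM hw)
  rwa [hclosed.closure_eq] at this

variable {S₁ S₂ : E →ₗ.[ℂ] E}

/-- Both hypotheses concern the same vector `(T + iτ)⁻¹x`, so their conclusions add. -/
theorem ResolventMapsDomain.add {l₁ l₂ : ℝ} (hT : IsSymmSurj A T)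
    (h₁ : ResolventMapsDomain T S₁ l₁) (h₂ : ResolventMapsDomain T S₂ l₂) :
    ResolventMapsDomain T (S₁ + S₂) (max 1 (max l₁ l₂)) := by
  rintro τ hτ ⟨x, x'⟩ hx
  have hτ0 : τ ≠ 0 := abs_pos.1 (zero_lt_one.trans_le ((le_max_left _ _).trans hτ))
  obtain ⟨x₁, x₂, hx₁, hx₂, rfl⟩ := mem_graph_add_iff.1 hx
  obtain ⟨-, y, t, s₁, p₁, q₁, d₁, e₁⟩ :=
    h₁ τ (((le_max_left _ _).trans (le_max_right _ _)).trans hτ) hx₁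
  obtain ⟨-, y', t', s₂, p₂, q₂, d₂, e₂⟩ :=
    h₂ τ (((le_max_right _ _).trans (le_max_right _ _)).trans hτ) hx₂
  have hyy : y' = y := hT.eq_of_shift_eq hτ0 d₂.left d₁.left (e₂.trans e₁.symm)
  subst hyy
  have htt : t' = t := T.mem_graph_snd_inj d₂.left d₁.left rfl
  subst htt
  exact ⟨hx, y', t', s₁ + s₂, p₁ + p₂, q₁ + q₂, ⟨d₁.left,
    mem_graph_add_iff.2 ⟨_, _, d₁.right, d₂.right, rfl⟩,
    T.graph.add_mem d₁.left_right d₂.left_right,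
    mem_graph_add_iff.2 ⟨_, _, d₁.right_left, d₂.right_left, rfl⟩⟩, e₁⟩

theorem FormEstimate.add {C₁₂ C l₁₂ l₁ l₂ l : ℝ} (hS₁ : IsSymmSurj A S₁)
    (hS₂ : IsSymmSurj A S₂) (hT : IsSymmSurj A T)
    (hE₁₂ : FormEstimate A S₁ S₂ C₁₂) (hR₁₂ : ResolventMapsDomain S₁ S₂ l₁₂)
    (hE₁ : FormEstimate A S₁ T C) (hR₁ : ResolventMapsDomain S₁ T l₁)
    (hE₂ : FormEstimate A S₂ T C) (hR₂ : ResolventMapsDomain S₂ T l₂)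
    (hR : ResolventMapsDomain T (S₁ + S₂) l) :
    FormEstimate A (S₁ + S₂) T (2 * C * (3 + C₁₂)) where
  pos := by have := hE₁₂.pos; have := hE₁.pos; positivity
  le {x s t p q} hd := by
    have hG : IsSymmSurj A (S₁ + S₂) := hS₁.add hS₂ hE₁₂ hR₁₂
    obtain ⟨s₁, s₂, hs₁, hs₂, rfl⟩ := mem_graph_add_iff.1 hd.left
    obtain ⟨h₁, le₁, hh₁⟩ := exists_extended_anticommutator hS₁ hT hE₁ hR₁ hs₁ hd.right
    obtain ⟨h₂, le₂, hh₂⟩ := exists_extended_anticommutator hS₂ hT hE₂ hR₂ hs₂ hd.right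
    -- `S₁x` and `S₂x` need not lie in `D(T)` separately, so the anticommutator is split only
    -- weakly, on a dense set.
    have e : p + q = h₁ + h₂ := by
      refine inner_ext_dense A (dense_domain_add hT hG.dense hR) fun u hu => ?_
      obtain ⟨w, hw⟩ := LinearPMap.mem_domain_iff.1 hu.1
      obtain ⟨v, hv⟩ := LinearPMap.mem_domain_iff.1 hu.2
      obtain ⟨v₁, v₂, hv₁, hv₂, rfl⟩ := mem_graph_add_iff.1 hv
      rw [← CStarModule.star_inner (p + q) u, ← CStarModule.star_inner (h₁ + h₂) u,
        hd.inner_anticommutator hG hT hv hw, CStarModule.inner_add_left (x := h₁),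
        hh₁ u v₁ w hv₁ hw, hh₂ u v₂ w hv₂ hw]
      congr 1
      simp only [CStarModule.inner_add_left, CStarModule.inner_add_right]
      abel
    have hC := hE₁.pos
    have hC₁₂ := hE₁₂.pos
    have hco := coercive hS₁ hS₂ hE₁₂ hR₁₂ hs₁ hs₂
    -- This gives `2C(2⟨x,x⟩ + ⟨s₁,s₁⟩ + ⟨s₂,s₂⟩ + 2⟨t,t⟩)`; coercivity raises the coefficient of
    -- `⟨x,x⟩` to `2C(3 + C₁₂)`. `n1` and `n2` pad the others up to it.
    have b1 := smul_le_smul_of_nonneg_left (add_le_add le₁ le₂) (zero_le_two (α := ℝ))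
    have b2 := smul_le_smul_of_nonneg_left hco (show 0 ≤ 2 * C by positivity)
    have n1 : (0 : A) ≤ (2 * C * (1 + C₁₂)) • inner A (s₁ + s₂) (s₁ + s₂) :=
      smul_nonneg (by positivity) CStarModule.inner_self_nonneg
    have n2 : (0 : A) ≤ (2 * C * (1 + C₁₂)) • inner A t t :=
      smul_nonneg (by positivity) CStarModule.inner_self_nonneg
    have b3 := inner_add_self_le A h₁ h₂
    rw [e]
    rw [← sub_nonneg] at b1 b2 b3 ⊢
    convert add_nonneg (add_nonneg b3 b1) (add_nonneg b2 (add_nonneg n1 n2)) using 1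
    module

end Swap

/-! ### Passage between the definitions of the statement and the working notions. -/

section Translation

variable {A : Type*} {E : Type*} [NonUnitalCStarAlgebra A] [PartialOrder A] [StarOrderedRing A]
  [NormedAddCommGroup E] [NormedSpace ℂ E] [SMul A E] [CStarModule A E]
  {S T : E →ₗ.[ℂ] E}

theorem IsSelfAdjointOp.symm (hT : IsSelfAdjointOp A T) {x x' y y' : E}
    (hx : (x, x') ∈ T.graph) (hy : (y, y') ∈ T.graph) : inner A x' y = inner A x y' := by
  have h : (y, y') ∈ adjointGraph A T := by rw [← hT.eq_adjoint]; exact hy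
  obtain ⟨u, hu, hu'⟩ := (LinearPMap.mem_graph_iff _).1 hx
  simp only at hu hu'
  rw [← hu, ← hu']
  exact h u

theorem IsSelfAdjointOp.isClosed_graph (hT : IsSelfAdjointOp A T) :
    IsClosed (T.graph : Set (E × E)) := by
  rw [hT.eq_adjoint, adjointGraph, Set.ofPred_forall]
  refine isClosed_iInter fun x => isClosed_eq ?_ ?_
  · exact CStarModule.continuous_inner.comp (continuous_const.prodMk continuous_fst)
  · exact CStarModule.continuous_inner.comp (continuous_const.prodMk continuous_snd)

theorem IsSelfAdjointOp.abs_im_mul_norm_le (hT : IsSelfAdjointOp A T) {x x' : E}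
    (hx : (x, x') ∈ T.graph) (l : ℂ) : |l.im| * ‖x‖ ≤ ‖x' + l • x‖ := by
  have h : inner A (x' + (l.re : ℂ) • x) x = inner A x (x' + (l.re : ℂ) • x) := by
    rw [CStarModule.inner_add_left, CStarModule.inner_add_right, hT.symm hx hx,
      CStarModule.inner_smul_left_complex, CStarModule.inner_smul_right_complex]
    simp
  have := abs_mul_norm_le A h l.im
  rwa [add_assoc, ← add_smul, re_add_im] at this

/-- Surjectivity of `T + l`. -/
def ShiftSurjective (T : E →ₗ.[ℂ] E) (l : ℂ) : Prop :=
  ∀ z, ∃ x x', (x, x') ∈ T.graph ∧ x' + l • x = z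

variable [CompleteSpace E]

theorem IsSelfAdjointOp.shiftSurjective_of_dense (hT : IsSelfAdjointOp A T) {l : ℂ}
    (hl : l.im ≠ 0) (hd : Dense (Set.range fun x : T.domain => T x + l • (x : E))) :
    ShiftSurjective T l := by
  intro z
  obtain ⟨w, hw, hlim⟩ := mem_closure_iff_seq_limit.1 (hd z)
  choose x hxw using hw
  have hb : ∀ m n, ‖(x m : E) - x n‖ ≤ |l.im|⁻¹ * ‖w m - w n‖ := fun m n => by
    have := hT.abs_im_mul_norm_le (T.graph.sub_mem (T.mem_graph (x m)) (T.mem_graph (x n))) l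
    rw [le_inv_mul_iff₀ (abs_pos.2 hl), ← hxw, ← hxw]
    refine this.trans_eq (congrArg _ ?_)
    module
  obtain ⟨x₀, hx₀⟩ := cauchySeq_tendsto_of_complete (cauchySeq_of_norm_sub_le hlim.cauchySeq _ hb)
  have hTx : Tendsto (fun n => T (x n)) atTop (𝓝 (z - l • x₀)) :=
    (hlim.sub (hx₀.const_smul l)).congr fun n => by rw [← hxw]; exact add_sub_cancel_right _ _
  exact ⟨x₀, z - l • x₀, hT.isClosed_graph.mem_of_tendsto (hx₀.prodMk_nhds hTx)
    (Eventually.of_forall fun n => T.mem_graph (x n)), by abel⟩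

/-- Since `(T + l)⁻¹` has norm at most `1/|Im l|`, the map `x ↦ (T + l)⁻¹(z - (m - l)x)` is a
contraction; its fixed point solves the equation for `m`. -/
theorem IsSelfAdjointOp.shiftSurjective_of_norm_lt (hT : IsSelfAdjointOp A T) {l m : ℂ}
    (h : ShiftSurjective T l) (hm : ‖m - l‖ < |l.im|) : ShiftSurjective T m := by
  have hl : 0 < |l.im| := (norm_nonneg _).trans_lt hm
  intro z
  choose r r' hr hr' using h
  have hLip : ∀ w w', ‖r w - r w'‖ ≤ |l.im|⁻¹ * ‖w - w'‖ := fun w w' => by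
    have := hT.abs_im_mul_norm_le (T.graph.sub_mem (hr w) (hr w')) l
    rw [le_inv_mul_iff₀ hl]
    refine this.trans_eq (congrArg _ ?_)
    conv_rhs => rw [← hr' w, ← hr' w']
    module
  have hK : ContractingWith (‖m - l‖₊ / ‖l.im‖₊)
      (fun x => r (z - (m - l) • x)) := by
    refine ⟨?_, LipschitzWith.of_dist_le_mul fun x y => ?_⟩
    · rw [← NNReal.coe_lt_coe]
      simpa using (div_lt_one hl).2 hm
    · rw [dist_eq_norm, dist_eq_norm]
      refine (hLip _ _).trans_eq ?_
      have : z - (m - l) • x - (z - (m - l) • y) = -((m - l) • (x - y)) := by module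
      rw [this, norm_neg, norm_smul]
      simp only [NNReal.coe_div, coe_nnnorm, Real.norm_eq_abs]
      field_simp
  obtain ⟨x, hx⟩ : ∃ x, r (z - (m - l) • x) = x :=
    ⟨_, hK.fixedPoint_isFixedPt⟩
  have h1 := hr (z - (m - l) • x)
  have h2 := hr' (z - (m - l) • x)
  rw [hx] at h1 h2
  refine ⟨x, _, h1, ?_⟩
  rw [eq_sub_of_add_eq h2]
  module

/-- Moving vertically away from the real axis by factors `3/2` stays within the admissible discs.
The discs of radius `|Im|` so obtained exhaust the open half-plane, so one contains `m`. -/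
theorem IsSelfAdjointOp.shiftSurjective_of_same_side (hT : IsSelfAdjointOp A T) {l m : ℂ}
    (h : ShiftSurjective T l) (hlm : 0 < l.im * m.im) : ShiftSurjective T m := by
  have hl0 : l.im ≠ 0 := left_ne_zero_of_mul hlm.ne'
  have hgrow : ∀ k : ℕ, ShiftSurjective T ⟨l.re, (3 / 2) ^ k * l.im⟩ := by
    intro k
    induction k with
    | zero => simpa using h
    | succ k ih =>
      refine hT.shiftSurjective_of_norm_lt ih ?_
      have hc : (3 / 2 : ℝ) ^ k ≠ 0 := by positivity
      rw [pow_succ]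
      generalize (3 / 2 : ℝ) ^ k = c at hc
      have e : (⟨l.re, c * (3 / 2) * l.im⟩ : ℂ) - ⟨l.re, c * l.im⟩ =
          ((c * l.im / 2 : ℝ) : ℂ) * I := by
        apply Complex.ext
        · simp
        · simp only [sub_im, mul_im, ofReal_re, ofReal_im, I_re, I_im]; ring
      rw [e, norm_mul, norm_I, mul_one, norm_real, Real.norm_eq_abs, abs_div, abs_two]
      exact half_lt_self (abs_pos.2 (mul_ne_zero hc hl0))
  obtain ⟨k, hk⟩ := pow_unbounded_of_one_lt
    (((m.re - l.re) ^ 2 + m.im ^ 2) / (2 * (l.im * m.im))) (show (1 : ℝ) < 3 / 2 by norm_num)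
  refine hT.shiftSurjective_of_norm_lt (hgrow k) ?_
  rw [div_lt_iff₀ (by positivity)] at hk
  refine lt_of_pow_lt_pow_left₀ 2 (abs_nonneg _) ?_
  rw [sq_abs, ← normSq_eq_norm_sq, normSq_apply]
  simp only [sub_re, sub_im]
  nlinarith

theorem IsSelfAdjointRegular.isSymmSurj (hT : IsSelfAdjointRegular A T) : IsSymmSurj A T where
  symm hx hy := hT.toIsSelfAdjointOp.symm hx hy
  dense := hT.dense_domain
  surj t ht := by
    obtain ⟨l, hl, hd, hd'⟩ := hT.regular
    have hT' := hT.toIsSelfAdjointOp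
    have h1 := hT'.shiftSurjective_of_dense hl hd
    have h2 := hT'.shiftSurjective_of_dense (l := -l) (by simpa using hl)
      (by simpa [sub_eq_add_neg] using hd')
    rcases lt_or_gt_of_ne (mul_ne_zero hl ht) with h | h
    · exact hT'.shiftSurjective_of_same_side h2 (by simpa using h)
    · exact hT'.shiftSurjective_of_same_side h1 (by simpa using h)

theorem IsSymmSurj.isSelfAdjointRegular (hT : IsSymmSurj A T)
    (smul_mem : ∀ (a : A) (x : T.domain), a • (x : E) ∈ T.domain)
    (map_smul : ∀ (a : A) (x : T.domain), T ⟨a • (x : E), smul_mem a x⟩ = a • T x) :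
    IsSelfAdjointRegular A T where
  dense_domain := hT.dense
  smul_mem := smul_mem
  map_smul := map_smul
  eq_adjoint := by
    ext ⟨y, z⟩
    constructor
    · intro h x
      exact hT.symm (T.mem_graph x) h
    · intro h
      refine hT.mem_graph_of_adjoint fun u v huv => ?_
      obtain ⟨x, rfl, rfl⟩ := (LinearPMap.mem_graph_iff _).1 huv
      exact h x
  regular := by
    refine ⟨I, by simp, fun z => subset_closure ?_, fun z => subset_closure ?_⟩
    · obtain ⟨x, x', hx, h⟩ := hT.surj 1 one_ne_zero z
      obtain ⟨w, rfl, rfl⟩ := (LinearPMap.mem_graph_iff _).1 hx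
      exact ⟨w, by simpa using h⟩
    · obtain ⟨x, x', hx, h⟩ := hT.surj (-1) (by norm_num) z
      obtain ⟨w, rfl, rfl⟩ := (LinearPMap.mem_graph_iff _).1 hx
      exact ⟨w, by simpa [sub_eq_add_neg] using h⟩

theorem isSelfAdjointRegular_add (hS : IsSelfAdjointOp A S) (hT : IsSelfAdjointOp A T)
    (h : IsSymmSurj A (S + T)) : IsSelfAdjointRegular A (S + T) := by
  refine h.isSelfAdjointRegular
    (fun a x => ⟨hS.smul_mem a ⟨x, x.2.1⟩, hT.smul_mem a ⟨x, x.2.2⟩⟩) fun a x => ?_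
  rw [LinearPMap.add_apply, LinearPMap.add_apply, op_smul_add, ← hS.map_smul, ← hT.map_smul]

theorem MemF.antiData {x : E} (hx : MemF S T x) :
    AntiData S T x (S ⟨x, hx.mem_left⟩) (T ⟨x, hx.mem_right⟩)
      (S ⟨T ⟨x, hx.mem_right⟩, hx.right_apply_mem⟩)
      (T ⟨S ⟨x, hx.mem_left⟩, hx.left_apply_mem⟩) :=
  ⟨S.mem_graph ⟨x, hx.mem_left⟩, T.mem_graph ⟨x, hx.mem_right⟩,
    S.mem_graph ⟨_, hx.right_apply_mem⟩, T.mem_graph ⟨_, hx.left_apply_mem⟩⟩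

theorem AntiData.memF {x s t p q : E} (h : AntiData S T x s t p q) :
    ∃ hx : MemF S T x, S ⟨x, hx.mem_left⟩ = s ∧ T ⟨x, hx.mem_right⟩ = t ∧
      anticommutator S T x hx = p + q := by
  obtain ⟨⟨y, hy⟩, rfl, rfl⟩ := (LinearPMap.mem_graph_iff _).1 h.left
  obtain ⟨⟨y', hy'⟩, e, rfl⟩ := (LinearPMap.mem_graph_iff _).1 h.right
  simp only at e
  subst e
  have hp := LinearPMap.mem_domain_of_mem_graph h.left_right
  have hq := LinearPMap.mem_domain_of_mem_graph h.right_left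
  refine ⟨⟨hy, hy', hq, hp⟩, rfl, rfl, ?_⟩
  rw [S.mem_graph_snd_inj h.left_right (S.mem_graph ⟨_, hp⟩) rfl,
    T.mem_graph_snd_inj h.right_left (T.mem_graph ⟨_, hq⟩) rfl]
  rfl

theorem WeaklyAnticommuting.exists_formEstimate (h : WeaklyAnticommuting A S T) :
    ∃ C, FormEstimate A S T C := by
  obtain ⟨C₀, C₁, C₂, h₀, h₁, h₂, hle⟩ := h.form_estimate
  refine ⟨max C₀ (max C₁ C₂), lt_max_of_lt_left h₀, fun {x s t p q} hd => ?_⟩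
  obtain ⟨hx, rfl, rfl, e⟩ := hd.memF
  rw [← e, smul_add, smul_add]
  refine (hle x hx).trans (add_le_add (add_le_add ?_ ?_) ?_)
  · exact smul_le_smul_of_nonneg_right (le_max_left _ _) CStarModule.inner_self_nonneg
  · exact smul_le_smul_of_nonneg_right ((le_max_left _ _).trans (le_max_right _ _))
      CStarModule.inner_self_nonneg
  · exact smul_le_smul_of_nonneg_right ((le_max_right _ _).trans (le_max_right _ _))
      CStarModule.inner_self_nonneg

/-- The closed `resolventGraph` contains the graph of `T` on the core, hence its closure, the graph
of `T`. -/
theorem WeaklyAnticommuting.exists_resolventMapsDomain (h : WeaklyAnticommuting A S T) :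
    ∃ l, ResolventMapsDomain S T l := by
  have hS := h.left_isSelfAdjointRegular.isSymmSurj
  have hT := h.right_isSelfAdjointRegular.isSymmSurj
  obtain ⟨C, hE⟩ := h.exists_formEstimate
  obtain ⟨V, hV, l₀, hl₀, hF⟩ := h.core_condition
  refine ⟨max l₀ (max (2 * √C) 1), fun τ hτ => ?_⟩
  rw [max_le_iff, max_le_iff] at hτ
  obtain ⟨hτ₀, hτC, hτ1⟩ := hτ
  have hτne : τ ≠ 0 := abs_pos.1 (zero_lt_one.trans_le hτ1)
  have hcl := isClosed_resolventGraph hS hT hE hτC hτ1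
  have hTcl : T.IsClosed := hT.isClosed_graph
  have hres : T.domRestrict V ≤ T := LinearPMap.domRestrict_le
  have hclos := (hTcl.isClosable.leIsClosable hres).graph_closure_eq_closure_graph
  rw [hV.closure_eq] at hclos
  rw [← hclos]
  refine Submodule.topologicalClosure_minimal _ ?_ hcl
  rintro ⟨x, x'⟩ hx
  have hxT : (x, x') ∈ T.graph := LinearPMap.le_graph_of_le hres hx
  have hxV : x ∈ V := by
    have := LinearPMap.mem_domain_of_mem_graph hx
    rw [LinearPMap.domRestrict_domain] at this
    exact this.1
  obtain ⟨⟨y, hy⟩, hyr, hyS⟩ := (LinearPMap.mem_graph_iff _).1 (hS.res_mem hτne x)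
  simp only at hyr hyS
  have hsum : S ⟨y, hy⟩ + ((τ : ℂ) * I) • y = x := by rw [hyS, ← hyr]; abel
  have hM : MemF S T y := hF τ hτ₀ y ⟨hy, by rw [hsum]; exact hxV⟩
  exact ⟨hxT, y, _, _, _, _, hM.antiData, hsum⟩

theorem weaklyAnticommuting_of_resolventMapsDomain (hS : IsSelfAdjointRegular A S)
    (hT : IsSelfAdjointRegular A T) {C l : ℝ} (hE : FormEstimate A S T C)
    (hR : ResolventMapsDomain S T l) : WeaklyAnticommuting A S T where
  left_isSelfAdjointRegular := hS
  right_isSelfAdjointRegular := hT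
  form_estimate := ⟨C, C, C, hE.pos, hE.pos, hE.pos, fun x hx => by
    rw [← smul_add, ← smul_add]
    exact hE.le hx.antiData⟩
  core_condition := by
    have hTcl : T.IsClosed := hT.isSymmSurj.isClosed_graph
    -- The whole of `D(T)` serves as the core.
    refine ⟨T.domain, ⟨le_rfl, ?_⟩, max l 1, by positivity, fun t ht x hx => ?_⟩
    · have h1 : T.domRestrict T.domain = T := by
        refine le_antisymm LinearPMap.domRestrict_le ⟨?_, ?_⟩
        · rw [LinearPMap.domRestrict_domain, inf_idem]
        · intro x y hxy
          exact (LinearPMap.domRestrict_apply hxy.symm).symm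
      rw [h1]
      refine LinearPMap.eq_of_eq_graph ?_
      rw [← hTcl.isClosable.graph_closure_eq_closure_graph]
      exact IsClosed.submodule_topologicalClosure_eq hTcl
    · obtain ⟨hxS, hxT⟩ := hx
      obtain ⟨z, hz⟩ := LinearPMap.mem_domain_iff.1 hxT
      obtain ⟨-, y, s, w, p, q, h, hy⟩ := hR t ((le_max_left _ _).trans ht) hz
      have ht0 : t ≠ 0 := abs_pos.1 (zero_lt_one.trans_le ((le_max_right _ _).trans ht))
      have hyx : y = x :=
        hS.isSymmSurj.eq_of_shift_eq ht0 h.left (S.mem_graph ⟨x, hxS⟩) hy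
      subst hyx
      exact h.memF.1

end Translation

end HilbertModuleOp


theorem theorem5p3 {A E : Type*} [NonUnitalCStarAlgebra A] [PartialOrder A] [StarOrderedRing A]
    [NormedAddCommGroup E] [NormedSpace ℂ E] [CompleteSpace E] [SMul A E] [CStarModule A E]
    (S₁ S₂ S₃ : E →ₗ.[ℂ] E)
    (h₁ : HilbertModuleOp.IsSelfAdjointRegular A S₁)
    (h₂ : HilbertModuleOp.IsSelfAdjointRegular A S₂)
    (h₃ : HilbertModuleOp.IsSelfAdjointRegular A S₃)
    (h₁₂ : HilbertModuleOp.WeaklyAnticommuting A S₁ S₂)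
    (h₂₃ : HilbertModuleOp.WeaklyAnticommuting A S₂ S₃)
    (h₁₃ : HilbertModuleOp.WeaklyAnticommuting A S₁ S₃) :
    HilbertModuleOp.WeaklyAnticommuting A (S₁ + S₂) S₃ ∧
      (S₁ + S₂ + S₃).domain = S₁.domain ⊓ S₂.domain ⊓ S₃.domain ∧
      HilbertModuleOp.IsSelfAdjointRegular A (S₁ + S₂ + S₃) := by
  have s₁ := h₁.isSymmSurj
  have s₂ := h₂.isSymmSurj
  have s₃ := h₃.isSymmSurj
  obtain ⟨C₁₂, hE₁₂⟩ := h₁₂.exists_formEstimate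
  obtain ⟨l₁₂, hR₁₂⟩ := h₁₂.exists_resolventMapsDomain
  obtain ⟨C₁₃, hE₁₃⟩ := h₁₃.exists_formEstimate
  obtain ⟨l₁₃, hR₁₃⟩ := h₁₃.exists_resolventMapsDomain
  obtain ⟨C₂₃, hE₂₃⟩ := h₂₃.exists_formEstimate
  obtain ⟨l₂₃, hR₂₃⟩ := h₂₃.exists_resolventMapsDomain
  have hsum := s₁.add s₂ hE₁₂ hR₁₂
  have hreg := HilbertModuleOp.isSelfAdjointRegular_add h₁.toIsSelfAdjointOp
    h₂.toIsSelfAdjointOp hsum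
  -- The sum is formed with the resolvent of `S₃` in front; `hR` below exchanges the roles back.
  have hR₃ := (hR₁₃.swap s₁ s₃ hE₁₃).add s₃ (hR₂₃.swap s₂ s₃ hE₂₃)
  have hE := HilbertModuleOp.FormEstimate.add s₁ s₂ s₃ hE₁₂ hR₁₂
    (hE₁₃.mono (le_max_left C₁₃ C₂₃)) hR₁₃ (hE₂₃.mono (le_max_right C₁₃ C₂₃)) hR₂₃ hR₃
  have hR := hR₃.swap s₃ hsum hE.symm
  exact ⟨HilbertModuleOp.weaklyAnticommuting_of_resolventMapsDomain hreg h₃ hE hR, rfl,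
    HilbertModuleOp.isSelfAdjointRegular_add hreg.toIsSelfAdjointOp h₃.toIsSelfAdjointOp
      (hsum.add s₃ hE hR)⟩
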